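/- Let $\beta\ge 0$, let $\{f_\theta:\theta\in\Theta\}$, $\Theta\subset\mathbb R^p$, be probability densities with respect to a $\sigma$-finite measure $\nu$ on a sample space $\mathcal X$, and let $X_1,X_2,\dots$ be i.i.d. with density $f_{\theta_0}$. Write $u_\theta(x)=\partial_\theta\log f_\theta(x)$ and, with $\xi_\beta(\theta)=\int u_\theta f_\theta^{1+\beta}\,d\nu$, $$J_\beta(\theta)=\int u_\theta u_\theta^{T}f_\theta^{1+\beta}\,d\nu,\qquad K_\beta(\theta)=\int u_\theta u_\theta^{T}f_\theta^{1+2\beta}\,d\nu-\xi_\beta(\theta)\xi_\beta(\theta)^{T}.$$ Let $V_\theta(x)=\int f_\theta^{1+\beta}d\nu-(1+\tfrac1\beta)f_\theta(x)^\beta$ for $\beta>0$ and $V_\theta(x)=-\log f_\theta(x)$ for $\beta=0$. A minimum density power divergence estimate from $X_1,\dots,X_n$ is a minimizer over $\Theta$ of $\frac1n\sum_{i=1}^n V_\theta(X_i)$, and the estimating equation is $$\frac1n\sum_{i=1}^n u_\theta(X_i)f_\theta(X_i)^\beta-\int u_\theta f_\theta^{1+\beta}\,d\nu=0 .$$ Assume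 that there is an open set $U\subset\Theta$ with $\theta_0\in U$ such that: 1. the set $\{x:f_\theta(x)>0\}$ is the same for all $\theta\in\Theta$; 2. for almost all $x$ in this set, $\theta\mapsto f_\theta(x)$ is three times continuously differentiable on $U$; 3. $\int f_\theta^{1+\beta}d\nu$ and $\int f_\theta^{\beta}f_{\theta_0}d\nu$ can be differentiated three times with respect to $\theta\in U$, and the derivatives can be taken under the integral sign; 4. $J_\beta(\theta_0)$ is positive definite; 5. there are functions $B_{jkl}$ with $E_{\theta_0}|B_{jkl}(X_1)|<\infty$ and, for almost all $x$ in the support, $|\partial_j\partial_k\partial_l V_\theta(x)|\le B_{jkl}(x)$ for all $\theta\in U$ and all $j,k,l$; 6. the integrals defining $J_\beta$ and $K_\beta$ converge on $U$, $J_\beta$ and $K_\beta$ are continuous on $U$, and $K_\beta(\theta_0)$ is nonsingular. Let $m:\mathbb R^p\to\mathbb R^r$ be continuously differentiable on $U$, let $M(\theta)=\partial m^{T}(\theta)/\partial\theta$ (a $p\times r$ matrix), suppose $\operatorname{rank}M(\theta_0)=r$, and let $\Theta_0=\{\theta\in\Theta:m(\theta)=0\}$. For an estimator $\widehat\theta_n$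 based on $X_1,\dots,X_n$ put $$W_n=n\,m(\widehat\theta_n)^{T}\Bigl[M^{T}(\widehat\theta_n)J_\beta^{-1}(\widehat\theta_n)K_\beta(\widehat\theta_n)J_\beta^{-1}(\widehat\theta_n)M(\widehat\theta_n)\Bigr]^{-1}m(\widehat\theta_n).$$ Suppose that the null hypothesis $H_0:\theta_0\in\Theta_0$ holds. Then there is a sequence of estimators, consistent for $\theta_0$, that solves the estimating equation with probability tending to one. Moreover, for every sequence of estimators $\widehat\theta_n$ that converges in probability to $\theta_0$ and that, with probability tending to one, is a minimum density power divergence estimate or solves the estimating equation, $W_n$ converges in law to the chi-square distribution with $r$ degrees of freedom. -/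

import Mathlib

open MeasureTheory ProbabilityTheory Filter Topology Matrix

noncomputable section

namespace MDPD

/-- The parameter space is a subset of `ℝ^p`. -/
abbrev Param (p : ℕ) : Type := EuclideanSpace ℝ (Fin p)

/-- The partial derivative `∂F/∂θ_j` of a real function on `ℝ^p`. -/
def partialD {p : ℕ} (j : Fin p) (F : Param p → ℝ) (θ : Param p) : ℝ :=
  fderiv ℝ F θ (EuclideanSpace.single j 1)

/-- The iterated partial derivative along a list of coordinates;
`iterPartial [j, k, l] F` is `∂_j ∂_k ∂_l F`. -/
def iterPartial {p : ℕ} (L : List (Fin p)) (F : Param p → ℝ) : Param p → ℝ :=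
  L.foldr partialD F

/-- `∫ h_θ(x) dP(x)` can be differentiated `N` times with respect to `θ ∈ U`, and the derivatives
can be taken under the integral sign. -/
def DiffUnderIntegral {p : ℕ} {𝒳 : Type*} [MeasurableSpace 𝒳] (P : Measure 𝒳)
    (h : Param p → 𝒳 → ℝ) (U : Set (Param p)) (N : ℕ) : Prop :=
  (∀ L : List (Fin p), L.length ≤ N → ∀ θ ∈ U,
    Integrable (fun x => iterPartial L (fun t => h t x) θ) P) ∧
  (∀ L : List (Fin p), L.length < N → ∀ θ ∈ U,
    DifferentiableAt ℝ (fun s => ∫ x, iterPartial L (fun t => h t x) s ∂P) θ ∧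
    ∀ j : Fin p, partialD j (fun s => ∫ x, iterPartial L (fun t => h t x) s ∂P) θ =
      ∫ x, iterPartial (j :: L) (fun t => h t x) θ ∂P)

section Model

variable {p : ℕ} {𝒳 : Type*} [MeasurableSpace 𝒳]

/-- The distribution with density `f_θ` with respect to the dominating measure `ν`. -/
def modelLaw (ν : Measure 𝒳) (f : Param p → 𝒳 → ℝ) (θ : Param p) : Measure 𝒳 :=
  ν.withDensity (fun x => ENNReal.ofReal (f θ x))

/-- `{f_θ : θ ∈ Θ}` is a family of probability densities with respect to `ν`. -/
structure IsDensityFamily (ν : Measure 𝒳) (f : Param p → 𝒳 → ℝ) (Θ : Set (Param p)) : Prop where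
  measurable : ∀ θ ∈ Θ, Measurable (f θ)
  nonneg : ∀ θ ∈ Θ, ∀ x, 0 ≤ f θ x
  mass_one : ∀ θ ∈ Θ, ∫⁻ x, ENNReal.ofReal (f θ x) ∂ν = 1

/-- The function `V_θ(x)`: `∫ f_θ^{1+β} dν - (1 + 1/β) f_θ(x)^β` for `β > 0`,
and `-log f_θ(x)` for `β = 0`. -/
def V (ν : Measure 𝒳) (f : Param p → 𝒳 → ℝ) (β : ℝ) (θ : Param p) (x : 𝒳) : ℝ :=
  if β = 0 then - Real.log (f θ x)
  else (∫ y, f θ y ^ (1 + β) ∂ν) - (1 + 1 / β) * f θ x ^ β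

/-- The empirical objective function `(1/n) ∑ V_θ(x_i)`. -/
def objective (ν : Measure 𝒳) (f : Param p → 𝒳 → ℝ) (β : ℝ) {n : ℕ} (x : Fin n → 𝒳)
    (θ : Param p) : ℝ :=
  (1 / (n : ℝ)) * ∑ i, V ν f β θ (x i)

/-- `θ` is a minimum density power divergence estimate for the sample `x`. -/
def IsMinimizer (ν : Measure 𝒳) (f : Param p → 𝒳 → ℝ) (β : ℝ) (Θ : Set (Param p)) {n : ℕ}
    (x : Fin n → 𝒳) (θ : Param p) : Prop :=
  θ ∈ Θ ∧ ∀ t ∈ Θ, objective ν f β x θ ≤ objective ν f β x t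

/-- The score function `u_θ(x) = ∂/∂θ log f_θ(x)`. -/
def score (f : Param p → 𝒳 → ℝ) (θ : Param p) (x : 𝒳) (j : Fin p) : ℝ :=
  partialD j (fun t => Real.log (f t x)) θ

/-- The Fisher information function `I_θ(x) = -∂u_θ(x)/∂θᵀ`. -/
def fisherInfo (f : Param p → 𝒳 → ℝ) (θ : Param p) (x : 𝒳) (j k : Fin p) : ℝ :=
  - partialD k (fun t => score f t x j) θ

/-- `θ ∈ Θ` solves the estimating equation
`(1/n) ∑ u_θ(x_i) f_θ(x_i)^β - ∫ u_θ f_θ^{1+β} dν = 0`. -/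
def IsRoot (ν : Measure 𝒳) (f : Param p → 𝒳 → ℝ) (β : ℝ) (Θ : Set (Param p)) {n : ℕ}
    (x : Fin n → 𝒳) (θ : Param p) : Prop :=
  θ ∈ Θ ∧ ∀ j, (1 / (n : ℝ)) * ∑ i, score f θ (x i) j * f θ (x i) ^ β
    - ∫ y, score f θ y j * f θ y ^ (1 + β) ∂ν = 0

/-- The matrix `J_β(θ)` when the true density is `g`. -/
def Jmat (ν : Measure 𝒳) (f : Param p → 𝒳 → ℝ) (β : ℝ) (g : 𝒳 → ℝ) (θ : Param p) :
    Matrix (Fin p) (Fin p) ℝ :=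
  Matrix.of fun j k =>
    (∫ x, score f θ x j * score f θ x k * f θ x ^ (1 + β) ∂ν) +
    ∫ x, (fisherInfo f θ x j k - β * (score f θ x j * score f θ x k)) * (g x - f θ x)
      * f θ x ^ β ∂ν

/-- The vector `ξ_β(θ)` when the true density is `g`. -/
def xiVec (ν : Measure 𝒳) (f : Param p → 𝒳 → ℝ) (β : ℝ) (g : 𝒳 → ℝ) (θ : Param p) :
    Fin p → ℝ :=
  fun j => ∫ x, score f θ x j * f θ x ^ β * g x ∂ν

/-- The matrix `K_β(θ)` when the true density is `g`. -/
def Kmat (ν : Measure 𝒳) (f : Param p → 𝒳 → ℝ) (β : ℝ) (g : 𝒳 → ℝ) (θ : Param p) :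
    Matrix (Fin p) (Fin p) ℝ :=
  Matrix.of fun j k =>
    (∫ x, score f θ x j * score f θ x k * f θ x ^ (2 * β) * g x ∂ν)
      - xiVec ν f β g θ j * xiVec ν f β g θ k

/-- `J_β(θ)` at the model, that is with `g = f_θ`. -/
def modelJ (ν : Measure 𝒳) (f : Param p → 𝒳 → ℝ) (β : ℝ) (θ : Param p) :
    Matrix (Fin p) (Fin p) ℝ :=
  Jmat ν f β (f θ) θ

/-- `K_β(θ)` at the model, that is with `g = f_θ`. -/
def modelK (ν : Measure 𝒳) (f : Param p → 𝒳 → ℝ) (β : ℝ) (θ : Param p) :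
    Matrix (Fin p) (Fin p) ℝ :=
  Kmat ν f β (f θ) θ

/-- The standard regularity conditions of minimum density power divergence estimation, when the
true density is the model density `f_{θ₀}`; `U` is the open neighbourhood of `θ₀` on which the
differentiability conditions hold. -/
structure Regular (ν : Measure 𝒳) (f : Param p → 𝒳 → ℝ) (β : ℝ) (Θ U : Set (Param p))
    (θ₀ : Param p) : Prop where
  /-- All the densities have the same support. -/
  common_support : ∃ S : Set 𝒳, ∀ θ ∈ Θ, {x | 0 < f θ x} = S
  isOpen : IsOpen U
  subset : U ⊆ Θ
  mem : θ₀ ∈ U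
  /-- For almost all `x` in the support, `f_θ(x)` is three times continuously differentiable. -/
  smooth : ∀ᵐ x ∂(modelLaw ν f θ₀), ContDiffOn ℝ 3 (fun θ => f θ x) U
  /-- `∫ f_θ^{1+β} dν` can be differentiated three times under the integral sign. -/
  diff_integral_model : DiffUnderIntegral ν (fun θ x => f θ x ^ (1 + β)) U 3
  /-- `∫ f_θ^β f_{θ₀} dν` can be differentiated three times under the integral sign. -/
  diff_integral_true : DiffUnderIntegral (modelLaw ν f θ₀) (fun θ x => f θ x ^ β) U 3
  /-- `J_β(θ₀)` is positive definite. -/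
  posDef : (Jmat ν f β (f θ₀) θ₀).PosDef
  /-- The third derivatives of `V_θ` are dominated by integrable functions. -/
  third_bound : ∃ B : Fin p → Fin p → Fin p → 𝒳 → ℝ,
    (∀ j k l, Integrable (B j k l) (modelLaw ν f θ₀)) ∧
    ∀ᵐ x ∂(modelLaw ν f θ₀), ∀ θ ∈ U, ∀ j k l,
      |iterPartial [j, k, l] (fun t => V ν f β t x) θ| ≤ B j k l x

/-- The integrals that define `J_β(θ)` and `K_β(θ)` at the model converge for `θ ∈ U`. -/
def HasFiniteJK (ν : Measure 𝒳) (f : Param p → 𝒳 → ℝ) (β : ℝ) (U : Set (Param p)) : Prop :=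
  ∀ θ ∈ U, ∀ j k,
    Integrable (fun x => score f θ x j * score f θ x k * f θ x ^ (1 + β)) ν ∧
    Integrable (fun x => score f θ x j * score f θ x k * f θ x ^ (2 * β) * f θ x) ν

/-- The `p × r` matrix `M(θ) = ∂mᵀ(θ)/∂θ`. -/
def Mmat {r : ℕ} (m : Param p → Fin r → ℝ) (θ : Param p) : Matrix (Fin p) (Fin r) ℝ :=
  Matrix.of fun i k => partialD i (fun t => m t k) θ

/-- The Wald-type test statistic for `m(θ) = 0`, for sample size `n` and estimate `θ`. -/
def wald (ν : Measure 𝒳) (f : Param p → 𝒳 → ℝ) (β : ℝ) {r : ℕ} (m : Param p → Fin r → ℝ)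
    (n : ℕ) (θ : Param p) : ℝ :=
  n * (m θ ⬝ᵥ (((Mmat m θ)ᵀ * (modelJ ν f β θ)⁻¹ * modelK ν f β θ * (modelJ ν f β θ)⁻¹
    * Mmat m θ)⁻¹ *ᵥ m θ))

end Model

/-- The first `n` observations. -/
def sample {Ω 𝒳 : Type*} (X : ℕ → Ω → 𝒳) (n : ℕ) (ω : Ω) : Fin n → 𝒳 := fun i => X i ω

/-- The chi-square distribution with `r` degrees of freedom: the law of the sum of the squares of
`r` independent standard normal variables. -/
def chiSquare (r : ℕ) : Measure ℝ :=
  (Measure.pi fun _ : Fin r => gaussianReal 0 1).map fun z => ∑ i, z i ^ 2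

instance (r : ℕ) : IsProbabilityMeasure (chiSquare r) :=
  Measure.isProbabilityMeasure_map
    (Measurable.aemeasurable
      (Finset.measurable_sum _ fun i _ => (measurable_pi_apply i).pow_const 2))

end MDPD

end

/-!
The estimating equation is `Ψ_n(θ) = 0`, where `Ψ_n` is the gradient of the empirical objective,
divided by `1 + β`, that is, the average of `g_θ(X_i)` with `g_θ = ∂_θ V_θ / (1 + β)`. The proof is
the classical one for Z-estimators.

*The model.* On `U`, for almost every `x` in the support, `g_θ = ξ_β(θ) - u_θ f_θ^β`
(`gradV_apply`). Hence `g_{θ₀}` has mean zero and covariance matrix `K_β(θ₀)`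
(`integral_gradV`, `integral_gradV_mul_gradV`), and the mean of its derivative is `J_β(θ₀)`
(`integrable_hessV_and_integral`). Writing `V_θ(x)` as `∫ f_θ^{1+β} dν` plus a function whose
gradient is `-(1 + β) u_θ f_θ^β` treats `β = 0` and `β > 0` together. The domination of the third
derivatives of `V` makes the derivative of `g_θ(x)` Lipschitz in `θ`, with an integrable constant.
These facts are what `IsEstimatingFunction` records (`isEstimatingFunction_gradV`).

*Existence.* By the law of large numbers the simplified Newton map `θ ↦ θ - J⁻¹ Ψ_n(θ)` is, with
probability tending to one, a contraction of arbitrarily small balls about `θ₀`, so it has a fixed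
point there, which is a consistent root. The limit of its iterates is a measurable function of the
sample, so no measurable selection theorem is needed (`exists_consistent_root`).

*Limit law.* A consistent estimator is eventually interior, so a minimizer is a root. A consistent
root satisfies `√n (T_n - θ₀) = -J⁻¹ √n Ψ_n(θ₀) + o_P(1)` (`asymptotically_linear`). By the
differentiability of `m` and the continuity of `J`, `K` and `M`, the statistic differs by `o_P(1)`
from `‖R Mᵀ J⁻¹ √n Ψ_n(θ₀)‖²`, where `RᵀR = (Mᵀ J⁻¹ K J⁻¹ M)⁻¹`
(`tendstoInDistribution_quadratic`). The vector inside the norm is a normalized sum of independent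
centred vectors with identity covariance, and the multivariate central limit theorem
(`tendstoInDistribution_multivariate_clt`) gives the chi-square limit.

Statements in probability are expressed by means of the filter `inProb` on `ℕ × Ω`, for which
convergence in probability to a constant is convergence in the usual sense.
-/

namespace MDPD

/-! ### Stochastic order calculus along a filter -/

section InProb

variable {Ω : Type*} [MeasurableSpace Ω] {μ : Measure Ω}

/-- The filter of sequences of events whose probability tends to one: a set of pairs `(n, ω)`
belongs to it when the (outer) measure of the `n`-th section of its complement tends to zero.
A statement holds eventually along this filter when it holds with probability tending to one, and
`Tendsto F (inProb μ) (𝓝 c)` is convergence in probability to the constant `c`, so the usual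
calculus of limits applies, without any measurability requirement. -/
def inProb (μ : Measure Ω) : Filter (ℕ × Ω) where
  sets := {A | Tendsto (fun n => μ {ω | (n, ω) ∉ A}) atTop (𝓝 0)}
  univ_sets := by simp
  sets_of_superset {A B} hA hAB := by
    refine tendsto_of_tendsto_of_tendsto_of_le_of_le tendsto_const_nhds hA
      (fun _ => zero_le) fun n => measure_mono fun ω hω h => hω (hAB h)
  inter_sets {A B} hA hB := by
    have h := Tendsto.add (Set.mem_ofPred_eq ▸ hA) (Set.mem_ofPred_eq ▸ hB)
    rw [add_zero] at h
    refine tendsto_of_tendsto_of_tendsto_of_le_of_le tendsto_const_nhds h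
      (fun _ => zero_le) fun n => ?_
    refine (measure_mono ?_).trans (measure_union_le _ _)
    intro ω hω
    by_contra hc
    simp only [Set.mem_union, Set.mem_ofPred_eq, not_or, not_not] at hc
    exact hω hc

theorem eventually_inProb {P : ℕ × Ω → Prop} :
    (∀ᶠ q in inProb μ, P q) ↔ Tendsto (fun n => μ {ω | ¬ P (n, ω)}) atTop (𝓝 0) :=
  Iff.rfl

theorem eventually_inProb_of_ae {P : ℕ × Ω → Prop} (h : ∀ᵐ ω ∂μ, ∀ n, P (n, ω)) :
    ∀ᶠ q in inProb μ, P q := by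
  rw [eventually_inProb]
  have : ∀ n, μ {ω | ¬ P (n, ω)} = 0 := fun n => by
    have := h.mono fun ω hω => hω n
    exact this
  simp [this]

theorem tendsto_fst_inProb : Tendsto Prod.fst (inProb μ) atTop := by
  refine tendsto_atTop.2 fun N => ?_
  rw [eventually_inProb]
  refine tendsto_const_nhds.congr' ?_
  filter_upwards [eventually_ge_atTop N] with n hn
  simp [hn]

theorem tendstoInMeasure_iff_tendsto_inProb {E : Type*} [PseudoMetricSpace E] {F : ℕ → Ω → E}
    {c : E} :
    TendstoInMeasure μ F atTop (fun _ => c) ↔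
      Tendsto (fun q : ℕ × Ω => F q.1 q.2) (inProb μ) (𝓝 c) := by
  rw [tendstoInMeasure_iff_dist, Metric.tendsto_nhds]
  refine forall₂_congr fun ε hε => ?_
  rw [eventually_inProb]
  simp only [not_lt]

/-- A sequence that converges in distribution is bounded in probability, hence its product with a
sequence that converges to zero in probability converges to zero in probability. -/
theorem tendsto_mul_norm_inProb [IsProbabilityMeasure μ] {E Ω' : Type*} [NormedAddCommGroup E]
    [MeasurableSpace E] [BorelSpace E] [MeasurableSpace Ω'] {μ' : Measure Ω'}
    [IsProbabilityMeasure μ'] {Z : ℕ → Ω → E} {Y : Ω' → E} {r : ℕ × Ω → ℝ}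
    (hZ : TendstoInDistribution Z atTop Y (fun _ => μ) μ')
    (hr : Tendsto r (inProb μ) (𝓝 0)) :
    Tendsto (fun q => r q * ‖Z q.1 q.2‖) (inProb μ) (𝓝 0) := by
  rw [Metric.tendsto_nhds]
  intro ε hε
  rw [eventually_inProb]
  rw [ENNReal.tendsto_nhds_zero]
  intro η hη
  -- a level `k` that the limit exceeds with probability less than `η / 2`
  have hk : ∃ k : ℕ, (μ'.map Y) {y | (k : ℝ) ≤ ‖y‖} < η / 2 := by
    have hprob : IsProbabilityMeasure (μ'.map Y) :=
      Measure.isProbabilityMeasure_map hZ.aemeasurable_limit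
    have hanti : Antitone fun k : ℕ => {y : E | (k : ℝ) ≤ ‖y‖} := fun a b hab y hy => by
      have : (a : ℝ) ≤ b := by exact_mod_cast hab
      exact this.trans hy
    have hlim := tendsto_measure_iInter_atTop (μ := μ'.map Y)
      (fun k : ℕ => (measurableSet_le measurable_const measurable_norm).nullMeasurableSet)
      hanti ⟨0, measure_ne_top _ _⟩
    have hempty : (⋂ k : ℕ, {y : E | (k : ℝ) ≤ ‖y‖}) = ∅ := by
      ext y
      simp only [Set.mem_iInter, Set.mem_ofPred_eq, Set.mem_empty_iff_false, iff_false, not_forall,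
        not_le]
      exact exists_nat_gt _
    rw [hempty, measure_empty] at hlim
    exact ((tendsto_order.1 hlim).2 _ (ENNReal.half_pos hη.ne')).exists
  obtain ⟨k, hk⟩ := hk
  have hclosed : IsClosed {y : E | (k : ℝ) ≤ ‖y‖} := isClosed_le continuous_const continuous_norm
  have hlim := ProbabilityMeasure.limsup_measure_closed_le_of_tendsto hZ.tendsto hclosed
  have h1 : ∀ᶠ n in atTop, μ {ω | (k : ℝ) ≤ ‖Z n ω‖} < η / 2 := by
    filter_upwards [eventually_lt_of_limsup_lt (hlim.trans_lt hk)] with n hn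
    refine lt_of_le_of_lt (le_of_eq ?_) hn
    exact (Measure.map_apply_of_aemeasurable (hZ.forall_aemeasurable n)
      hclosed.measurableSet).symm
  have hpos : 0 < ε / (k + 1) := by positivity
  have h2 := (Metric.tendsto_nhds.1 hr) _ hpos
  rw [eventually_inProb, ENNReal.tendsto_nhds_zero] at h2
  filter_upwards [h1, h2 (η / 2) (ENNReal.half_pos hη.ne')] with n hn1 hn2
  calc _ ≤ μ ({ω | (k : ℝ) ≤ ‖Z n ω‖} ∪ {ω | ¬ dist (r (n, ω)) 0 < ε / (k + 1)}) := by
        refine measure_mono fun ω hω => ?_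
        by_contra hc
        simp only [Set.mem_union, Set.mem_ofPred_eq, not_or, not_not, not_le, dist_zero_right,
          Real.norm_eq_abs] at hc
        apply hω
        simp only [dist_zero_right, norm_mul, Real.norm_eq_abs, abs_norm]
        have : |r (n, ω)| * ‖Z n ω‖ ≤ |r (n, ω)| * (k + 1) := by
          gcongr
          linarith [hc.1]
        exact this.trans_lt ((lt_div_iff₀ (by positivity)).1 hc.2)
    _ ≤ η / 2 + η / 2 := (measure_union_le _ _).trans (add_le_add hn1.le hn2)
    _ = η := ENNReal.add_halves η

end InProb

/-! ### Limit theorems for independent identically distributed observations -/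

section Limit

variable {Ω 𝒳 : Type*} [MeasurableSpace Ω] [MeasurableSpace 𝒳] {μ : Measure Ω}
  [IsProbabilityMeasure μ] {X : ℕ → Ω → 𝒳} {P : Measure 𝒳}

/-- Weak law of large numbers for a function of the observations. -/
theorem tendsto_average_inProb (hX : ∀ i, Measurable (X i)) (hindep : iIndepFun X μ)
    (hlaw : ∀ i, μ.map (X i) = P) {F : Type*} [NormedAddCommGroup F] [NormedSpace ℝ F]
    [CompleteSpace F] [MeasurableSpace F] [BorelSpace F]
    {h : 𝒳 → F} (hh : Integrable h P) :
    Tendsto (fun q : ℕ × Ω => (q.1 : ℝ)⁻¹ • ∑ i : Fin q.1, h (X i q.2)) (inProb μ)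
      (𝓝 (∫ x, h x ∂P)) := by
  have hint : ∀ i, Integrable (fun ω => h (X i ω)) μ := fun i => by
    have : Integrable h (μ.map (X i)) := by rw [hlaw i]; exact hh
    exact this.comp_measurable (hX i)
  have hmean : ∫ ω, h (X 0 ω) ∂μ = ∫ x, h x ∂P := by
    rw [← hlaw 0, integral_map (hX 0).aemeasurable]
    rw [hlaw 0]; exact hh.aestronglyMeasurable
  have hid : ∀ i, IdentDistrib (fun ω => h (X i ω)) (fun ω => h (X 0 ω)) μ μ := fun i => by
    have h0 : IdentDistrib (X i) (X 0) μ μ :=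
      ⟨(hX i).aemeasurable, (hX 0).aemeasurable, by rw [hlaw i, hlaw 0]⟩
    refine h0.comp_of_aemeasurable ?_
    rw [hlaw i]; exact hh.aemeasurable
  have hpair : Pairwise (Function.onFun (· ⟂ᵢ[μ] ·) fun i ω => h (X i ω)) := fun i j hij => by
    refine (hindep.indepFun hij).comp₀ (φ := h) (ψ := h) (hX i).aemeasurable (hX j).aemeasurable ?_ ?_
    · rw [hlaw i]; exact hh.aemeasurable
    · rw [hlaw j]; exact hh.aemeasurable
  have hlim := strong_law_ae (fun i ω => h (X i ω)) (hint 0) hpair hid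
  rw [← tendstoInMeasure_iff_tendsto_inProb
    (F := fun n ω => (n : ℝ)⁻¹ • ∑ i : Fin n, h (X i ω))]
  refine tendstoInMeasure_of_tendsto_ae (fun n => ?_) ?_
  · refine AEStronglyMeasurable.const_smul ?_ _
    exact Finset.aestronglyMeasurable_fun_sum _ fun i _ => (hint i).aestronglyMeasurable
  · filter_upwards [hlim] with ω hω
    simp only [hmean, Finset.sum_range] at hω
    exact hω

open scoped RealInnerProductSpace in
/-- The multivariate central limit theorem, by the Cramér–Wold device and Lévy's theorem. -/
theorem tendstoInDistribution_multivariate_clt (hX : ∀ i, Measurable (X i))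
    (hindep : iIndepFun X μ) (hlaw : ∀ i, μ.map (X i) = P) {r : ℕ}
    {h : 𝒳 → EuclideanSpace ℝ (Fin r)} (hh : MemLp h 2 P) (h0 : ∫ x, h x ∂P = 0)
    {S : Matrix (Fin r) (Fin r) ℝ} (hS : S.PosSemidef)
    (hcov : ∀ j k, ∫ x, h x j * h x k ∂P = S j k) :
    TendstoInDistribution (fun (n : ℕ) ω => (√n)⁻¹ • ∑ i : Fin n, h (X i ω)) atTop
      (fun z => z) (fun _ => μ) (multivariateGaussian 0 S) := by
  have hPp : IsProbabilityMeasure P := by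
    rw [← hlaw 0]; exact Measure.isProbabilityMeasure_map (hX 0).aemeasurable
  have hLp : ∀ i, MemLp (fun ω => h (X i ω)) 2 μ := fun i => by
    have : MemLp h 2 (μ.map (X i)) := by rw [hlaw i]; exact hh
    exact this.comp_of_map (hX i).aemeasurable
  have hmeas : ∀ n : ℕ, AEMeasurable (fun ω => (√n)⁻¹ • ∑ i : Fin n, h (X i ω)) μ := fun n =>
    (measurable_const_smul (√n)⁻¹).comp_aemeasurable (Finset.aemeasurable_fun_sum _ fun i _ =>
      (hLp i).aestronglyMeasurable.aemeasurable)
  refine ⟨hmeas, aemeasurable_id, ?_⟩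
  refine ProbabilityMeasure.tendsto_iff_tendsto_charFun.2 fun t => ?_
  have hhm : AEMeasurable (fun x => ⟪t, h x⟫) P :=
    hh.aestronglyMeasurable.aemeasurable.const_inner
  have hid : ∀ i, IdentDistrib (fun ω => ⟪t, h (X i ω)⟫) (fun ω => ⟪t, h (X 0 ω)⟫) μ μ :=
    fun i => by
    have h0 : IdentDistrib (X i) (X 0) μ μ :=
      ⟨(hX i).aemeasurable, (hX 0).aemeasurable, by rw [hlaw i, hlaw 0]⟩
    refine h0.comp_of_aemeasurable (u := fun x => ⟪t, h x⟫) ?_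
    rw [hlaw i]; exact hhm
  have hind : iIndepFun (fun i ω => ⟪t, h (X i ω)⟫) μ :=
    hindep.comp₀ (fun _ x => ⟪t, h x⟫) (fun i => (hX i).aemeasurable)
      fun i => by rw [hlaw i]; exact hhm
  have hmean : ∫ ω, ⟪t, h (X 0 ω)⟫ ∂μ = 0 := by
    rw [integral_inner ((hLp 0).integrable one_le_two),
      ← integral_map (f := h) (hX 0).aemeasurable, hlaw 0, h0, inner_zero_right]
    rw [hlaw 0]; exact hh.aestronglyMeasurable
  have hcoord : ∀ j, MemLp (fun x => h x j) 2 P := fun j =>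
    hh.continuousLinearMap_comp (EuclideanSpace.proj j : EuclideanSpace ℝ (Fin r) →L[ℝ] ℝ)
  have hvar : ∫ ω, ⟪t, h (X 0 ω)⟫ ^ 2 ∂μ = t ⬝ᵥ S *ᵥ t := by
    rw [← integral_map (f := fun x => ⟪t, h x⟫ ^ 2) (hX 0).aemeasurable, hlaw 0]
    · have : ∀ x, ⟪t, h x⟫ ^ 2 = ∑ j, ∑ k, t j * t k * (h x j * h x k) := fun x => by
        rw [PiLp.inner_apply, sq, Finset.sum_mul_sum]
        refine Finset.sum_congr rfl fun j _ => Finset.sum_congr rfl fun k _ => ?_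
        simp; ring
      simp_rw [this]
      have hi : ∀ j k, Integrable (fun x => t j * t k * (h x j * h x k)) P := fun j k =>
        ((hcoord j).integrable_mul (hcoord k)).const_mul _
      rw [integral_finsetSum _ fun j _ => integrable_finsetSum _ fun k _ => hi j k]
      simp_rw [integral_finsetSum _ fun k _ => hi _ k, integral_const_mul, hcov]
      simp only [dotProduct, mulVec, Finset.mul_sum]
      refine Finset.sum_congr rfl fun j _ => Finset.sum_congr rfl fun k _ => ?_
      ring
    · rw [hlaw 0]; exact (hhm.pow_const 2).aestronglyMeasurable
  have hmemt : MemLp (fun ω => ⟪t, h (X 0 ω)⟫) 2 μ := (hLp 0).const_inner t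
  have hVar : Var[fun ω => ⟪t, h (X 0 ω)⟫; μ] = t ⬝ᵥ S *ᵥ t := by
    rw [variance_of_integral_eq_zero hmemt.aestronglyMeasurable.aemeasurable hmean]
    exact hvar
  have h1 := tendstoInDistribution_inv_sqrt_mul_sum_sub (Y := fun x : ℝ => x)
    (P' := gaussianReal 0 Var[fun ω => ⟪t, h (X 0 ω)⟫; μ].toNNReal)
    ⟨aemeasurable_id, by simp⟩ hmemt hind hid
  have h2 := ProbabilityMeasure.tendsto_iff_tendsto_charFun.1 h1.tendsto 1
  have e1 : ∀ n : ℕ, charFun (μ.map fun ω => (√n)⁻¹ *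
      (∑ k ∈ Finset.range n, ⟪t, h (X k ω)⟫ - n * ∫ ω, ⟪t, h (X 0 ω)⟫ ∂μ)) 1
      = charFun (μ.map fun ω => (√n)⁻¹ • ∑ i : Fin n, h (X i ω)) t := fun n => by
    rw [charFun_apply, charFun_apply, integral_map, integral_map (hmeas n)]
    · refine integral_congr_ae (Eventually.of_forall fun ω => ?_)
      simp only [hmean, mul_zero, sub_zero, Finset.sum_range,
        real_inner_comm t ((√n)⁻¹ • _), real_inner_smul_right, inner_sum]
      simp
    · exact (Measurable.aestronglyMeasurable (by fun_prop))
    · exact (Finset.aemeasurable_fun_sum _ fun i _ =>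
        (hid i).aemeasurable_fst).sub_const _ |>.const_mul _
    · exact (Measurable.aestronglyMeasurable (by fun_prop))
  have e2 : charFun ((gaussianReal 0 Var[fun ω => ⟪t, h (X 0 ω)⟫; μ].toNNReal).map
      fun x : ℝ => x) 1 = charFun ((multivariateGaussian 0 S).map fun z => z) t := by
    rw [Measure.map_id', Measure.map_id', charFun_gaussianReal, charFun_multivariateGaussian hS,
      Real.coe_toNNReal _ (variance_nonneg _ _), hVar]
    simp
  simp only [ProbabilityMeasure.coe_mk] at h2 ⊢
  rw [← e2]
  exact h2.congr e1

theorem map_multivariateGaussian_norm_sq (r : ℕ) :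
    (multivariateGaussian 0 (1 : Matrix (Fin r) (Fin r) ℝ)).map (fun z => ‖z‖ ^ 2)
      = chiSquare r := by
  rw [multivariateGaussian_zero_one, ← map_pi_eq_stdGaussian, Measure.map_map (by fun_prop)
    (by fun_prop)]
  unfold chiSquare
  congr 1
  ext z
  simp [EuclideanSpace.real_norm_sq_eq]

end Limit

/-! ### Estimating equations -/

section Estimating

variable {𝒳 : Type*} {p : ℕ}

/-- The average of a function over a sample. -/
noncomputable def average {F : Type*} [AddCommGroup F] [Module ℝ F] {n : ℕ} (h : 𝒳 → F)
    (x : Fin n → 𝒳) : F :=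
  (n : ℝ)⁻¹ • ∑ i, h (x i)

theorem average_apply {n : ℕ} (h : 𝒳 → Param p) (x : Fin n → 𝒳) (j : Fin p) :
    average h x j = (n : ℝ)⁻¹ * ∑ i, h (x i) j := by
  simp [average]

variable [MeasurableSpace 𝒳]

/-- An unbiased estimating function `g` with integrable linearization `D` at `θ₀`, whose mean `A`
is invertible. On the set `G` of full measure, the deviation of `g` from its linearization is
controlled, on small balls, by an integrable Lipschitz constant for the derivative of `g`. -/
structure IsEstimatingFunction (P : Measure 𝒳) (g : Param p → 𝒳 → Param p) (θ₀ : Param p) (δ : ℝ)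
    (G : Set 𝒳) (D : 𝒳 → Param p →L[ℝ] Param p) (B : 𝒳 → ℝ) (A : Param p ≃L[ℝ] Param p) :
    Prop where
  pos : 0 < δ
  measurableSet : MeasurableSet G
  ae_mem : ∀ᵐ x ∂P, x ∈ G
  measurable : ∀ θ ∈ Metric.closedBall θ₀ δ, Measurable (G.indicator (g θ))
  linear : ∀ x ∈ G, ∀ ρ ≤ δ, ∀ θ ∈ Metric.closedBall θ₀ ρ, ∀ θ' ∈ Metric.closedBall θ₀ ρ,
    ‖g θ x - g θ' x - D x (θ - θ')‖ ≤ B x * ρ * ‖θ - θ'‖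
  integrable_deriv : Integrable D P
  integrable_bound : Integrable B P
  integrable : Integrable (g θ₀) P
  integral_deriv : ∫ x, D x ∂P = A
  integral_eq_zero : ∫ x, g θ₀ x ∂P = 0

namespace IsEstimatingFunction

variable {P : Measure 𝒳} {g : Param p → 𝒳 → Param p} {θ₀ : Param p} {δ : ℝ} {G : Set 𝒳}
  {D : 𝒳 → Param p →L[ℝ] Param p} {B : 𝒳 → ℝ} {A : Param p ≃L[ℝ] Param p}

theorem norm_average_sub_le (hg : IsEstimatingFunction P g θ₀ δ G D B A) {n : ℕ}
    {x : Fin n → 𝒳} (hx : ∀ i, x i ∈ G) {ρ : ℝ} (hρ : ρ ≤ δ) {θ θ' : Param p}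
    (hθ : θ ∈ Metric.closedBall θ₀ ρ) (hθ' : θ' ∈ Metric.closedBall θ₀ ρ) :
    ‖average (g θ) x - average (g θ') x - average D x (θ - θ')‖
      ≤ average B x * ρ * ‖θ - θ'‖ := by
  have e : average (g θ) x - average (g θ') x - average D x (θ - θ')
      = (n : ℝ)⁻¹ • ∑ i, (g θ (x i) - g θ' (x i) - D (x i) (θ - θ')) := by
    simp only [average, Finset.sum_sub_distrib, smul_sub, _root_.smul_apply,
      _root_.sum_apply]
  rw [e, norm_smul, Real.norm_of_nonneg (by positivity)]
  simp only [average, smul_eq_mul, mul_assoc, Finset.sum_mul]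
  gcongr
  refine (norm_sum_le _ _).trans (Finset.sum_le_sum fun i _ => ?_)
  rw [← mul_assoc]
  exact hg.linear _ (hx i) ρ hρ θ hθ θ' hθ'

/-- The simplified Newton map `θ ↦ θ - A⁻¹ Ψ_n(θ)`, whose fixed points are the roots of the
estimating equation. -/
noncomputable def newton (g : Param p → 𝒳 → Param p) (A : Param p ≃L[ℝ] Param p) {n : ℕ}
    (x : Fin n → 𝒳) (θ : Param p) : Param p :=
  θ - A.symm (average (g θ) x)

theorem norm_newton_sub_le (hg : IsEstimatingFunction P g θ₀ δ G D B A) {n : ℕ}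
    {x : Fin n → 𝒳} (hx : ∀ i, x i ∈ G) {ρ : ℝ} (hρ : ρ ≤ δ) {θ θ' : Param p}
    (hθ : θ ∈ Metric.closedBall θ₀ ρ) (hθ' : θ' ∈ Metric.closedBall θ₀ ρ) :
    ‖newton g A x θ - newton g A x θ'‖ ≤
      ‖(A.symm : Param p →L[ℝ] Param p)‖ *
        (‖average D x - (A : Param p →L[ℝ] Param p)‖ + average B x * ρ) * ‖θ - θ'‖ := by
  have e : newton g A x θ - newton g A x θ' = (A.symm : Param p →L[ℝ] Param p)
      (-((average D x - (A : Param p →L[ℝ] Param p)) (θ - θ')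
        + (average (g θ) x - average (g θ') x - average D x (θ - θ')))) := by
    simp only [newton, _root_.sub_apply, ContinuousLinearEquiv.coe_coe, map_neg,
      map_add, map_sub, ContinuousLinearEquiv.symm_apply_apply]
    abel
  rw [e, mul_assoc, add_mul]
  refine (ContinuousLinearMap.le_opNorm _ _).trans ?_
  gcongr
  rw [norm_neg]
  refine (norm_add_le _ _).trans (add_le_add (ContinuousLinearMap.le_opNorm _ _) ?_)
  exact hg.norm_average_sub_le hx hρ hθ hθ'

/-- The radial retraction of the space onto the closed ball of radius `ρ` about `θ₀`. -/
noncomputable def retract (θ₀ : Param p) (ρ : ℝ) (θ : Param p) : Param p :=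
  θ₀ + (ρ / max ρ ‖θ - θ₀‖) • (θ - θ₀)

theorem continuous_retract {ρ : ℝ} (hρ : 0 < ρ) : Continuous (retract θ₀ ρ) := by
  unfold retract
  have : ∀ θ : Param p, max ρ ‖θ - θ₀‖ ≠ 0 := fun θ => (lt_max_of_lt_left hρ).ne'
  fun_prop (disch := exact this _)

theorem retract_mem {ρ : ℝ} (hρ : 0 < ρ) (θ : Param p) :
    retract θ₀ ρ θ ∈ Metric.closedBall θ₀ ρ := by
  have h : 0 < max ρ ‖θ - θ₀‖ := lt_max_of_lt_left hρ
  rw [mem_closedBall_iff_norm, retract, add_sub_cancel_left, norm_smul,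
    Real.norm_of_nonneg (by positivity), div_mul_eq_mul_div, div_le_iff₀ h]
  gcongr
  exact le_max_right _ _

theorem retract_of_mem {ρ : ℝ} (hρ : 0 < ρ) {θ : Param p} (hθ : θ ∈ Metric.closedBall θ₀ ρ) :
    retract θ₀ ρ θ = θ := by
  rw [mem_closedBall_iff_norm] at hθ
  rw [retract, max_eq_left hθ, div_self hρ.ne', one_smul, add_sub_cancel]

/-- The limit of the iterates of the simplified Newton map, started at `θ₀`, retracted to the ball
of radius `ρ`. The estimating function is cut off outside of `G` and precomposed with the
retraction, which makes every iterate a measurable function of the sample. -/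
noncomputable def newtonLimit (g : Param p → 𝒳 → Param p) (A : Param p ≃L[ℝ] Param p)
    (G : Set 𝒳) (θ₀ : Param p) (ρ : ℝ) (n : ℕ) (x : Fin n → 𝒳) : Param p :=
  retract θ₀ ρ (limUnder atTop fun k =>
    (newton (fun θ => G.indicator (g (retract θ₀ ρ θ))) A x)^[k] θ₀)

theorem continuous_indicator_retract (hg : IsEstimatingFunction P g θ₀ δ G D B A) {ρ : ℝ}
    (hρ : 0 < ρ) (hρδ : ρ ≤ δ) (x : 𝒳) :
    Continuous fun θ => G.indicator (g (retract θ₀ ρ θ)) x := by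
  by_cases hx : x ∈ G
  · simp only [Set.indicator_of_mem hx]
    have hc : ContinuousOn (fun θ => g θ x) (Metric.closedBall θ₀ ρ) := by
      have : LipschitzOnWith (Real.toNNReal (‖D x‖ + B x * ρ)) (fun θ => g θ x)
          (Metric.closedBall θ₀ ρ) := by
        refine LipschitzOnWith.of_dist_le' fun θ hθ θ' hθ' => ?_
        rw [dist_eq_norm, dist_eq_norm, add_mul]
        calc ‖g θ x - g θ' x‖ = ‖D x (θ - θ') + (g θ x - g θ' x - D x (θ - θ'))‖ := by
              congr 1; abel
          _ ≤ _ := (norm_add_le _ _).trans (add_le_add (ContinuousLinearMap.le_opNorm _ _)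
              (hg.linear x hx ρ hρδ θ hθ θ' hθ'))
      exact this.continuousOn
    exact hc.comp_continuous (continuous_retract hρ) (retract_mem hρ)
  · simp only [Set.indicator_of_notMem hx]
    exact continuous_const

theorem measurable_newtonLimit (hg : IsEstimatingFunction P g θ₀ δ G D B A) {ρ : ℝ}
    (hρ : 0 < ρ) (hρδ : ρ ≤ δ) (n : ℕ) : Measurable (newtonLimit g A G θ₀ ρ n) := by
  refine (continuous_retract hρ).measurable.comp ?_
  have hjoint : Measurable (Function.uncurry fun (θ : Param p) (x : Fin n → 𝒳) =>
      newton (fun θ => G.indicator (g (retract θ₀ ρ θ))) A x θ) := by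
    refine measurable_uncurry_of_continuous_of_measurable (fun x => ?_) fun θ => ?_
    · unfold newton average
      refine continuous_id.sub (A.symm.continuous.comp ((continuous_const_smul _).comp ?_))
      exact continuous_finsetSum _ fun i _ => hg.continuous_indicator_retract hρ hρδ (x i)
    · unfold newton average
      refine measurable_const.sub (A.symm.continuous.measurable.comp
        ((measurable_const_smul _).comp (Finset.measurable_sum _ fun i _ => ?_)))
      exact (hg.measurable _ (Metric.closedBall_subset_closedBall hρδ (retract_mem hρ θ))).comp
        (measurable_pi_apply i)
  have hiter : ∀ k : ℕ, Measurable fun x : Fin n → 𝒳 =>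
      (newton (fun θ => G.indicator (g (retract θ₀ ρ θ))) A x)^[k] θ₀ := fun k => by
    induction k with
    | zero => exact measurable_const
    | succ k ih =>
      simp only [Function.iterate_succ_apply']
      exact hjoint.comp (ih.prodMk measurable_id)
  exact (StronglyMeasurable.limUnder fun k => (hiter k).stronglyMeasurable).measurable

/-- If the linearization is close to its mean, the simplified Newton map is a contraction, and its
fixed point is a root close to `θ₀`. -/
theorem newtonLimit_spec (hg : IsEstimatingFunction P g θ₀ δ G D B A) {ρ : ℝ}
    (hρ : 0 < ρ) (hρδ : ρ ≤ δ) {n : ℕ} {x : Fin n → 𝒳} (hx : ∀ i, x i ∈ G)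
    (hc : ‖(A.symm : Param p →L[ℝ] Param p)‖ *
        (‖average D x - (A : Param p →L[ℝ] Param p)‖ + average B x * ρ) ≤ 1 / 2)
    {η : ℝ} (hη : 2 * η ≤ ρ) (h0 : ‖A.symm (average (g θ₀) x)‖ ≤ η) :
    newtonLimit g A G θ₀ ρ n x ∈ Metric.closedBall θ₀ (2 * η) ∧
      average (g (newtonLimit g A G θ₀ ρ n x)) x = 0 := by
  have hη0 : 0 ≤ η := (norm_nonneg _).trans h0
  set F : Param p → Param p := newton (fun θ => G.indicator (g (retract θ₀ ρ θ))) A x with hF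
  have hFN : ∀ θ ∈ Metric.closedBall θ₀ ρ, F θ = newton g A x θ := fun θ hθ => by
    simp only [hF, newton, average, retract_of_mem hρ hθ, Set.indicator_of_mem (hx _)]
  have hsub : Metric.closedBall θ₀ (2 * η) ⊆ Metric.closedBall θ₀ ρ :=
    Metric.closedBall_subset_closedBall hη
  have hmem0 : θ₀ ∈ Metric.closedBall θ₀ (2 * η) := Metric.mem_closedBall_self (by linarith)
  have hcontr : ∀ θ ∈ Metric.closedBall θ₀ (2 * η), ∀ θ' ∈ Metric.closedBall θ₀ (2 * η),
      ‖F θ - F θ'‖ ≤ 1 / 2 * ‖θ - θ'‖ := fun θ hθ θ' hθ' => by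
    rw [hFN θ (hsub hθ), hFN θ' (hsub hθ')]
    refine (hg.norm_newton_sub_le hx hρδ (hsub hθ) (hsub hθ')).trans ?_
    gcongr
  have hF0 : ‖F θ₀ - θ₀‖ ≤ η := by
    rw [hFN θ₀ (hsub hmem0), newton, sub_sub_cancel_left, norm_neg]
    exact h0
  have hmaps : Set.MapsTo F (Metric.closedBall θ₀ (2 * η)) (Metric.closedBall θ₀ (2 * η)) :=
    fun θ hθ => by
      rw [mem_closedBall_iff_norm] at *
      calc ‖F θ - θ₀‖ = ‖(F θ - F θ₀) + (F θ₀ - θ₀)‖ := by congr 1; abel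
        _ ≤ 1 / 2 * ‖θ - θ₀‖ + η := (norm_add_le _ _).trans
            (add_le_add (hcontr θ (mem_closedBall_iff_norm.2 hθ) θ₀ hmem0) hF0)
        _ ≤ 2 * η := by linarith
  have hcw : ContractingWith (1 / 2 : NNReal)
      (hmaps.restrict F (Metric.closedBall θ₀ (2 * η)) (Metric.closedBall θ₀ (2 * η))) := by
    refine ⟨by norm_num, LipschitzWith.of_dist_le_mul fun a b => ?_⟩
    rw [Subtype.dist_eq, Subtype.dist_eq, dist_eq_norm, dist_eq_norm]
    simpa using hcontr a a.2 b b.2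
  obtain ⟨y, hy, hfix, hlim, -⟩ := hcw.exists_fixedPoint' Metric.isClosed_closedBall.isComplete
    hmaps hmem0 (edist_ne_top _ _)
  have hT : newtonLimit g A G θ₀ ρ n x = y := by
    rw [newtonLimit, hlim.limUnder_eq, retract_of_mem hρ (hsub hy)]
  rw [hT]
  refine ⟨hy, ?_⟩
  have h1 : newton g A x y = y := by rw [← hFN y (hsub hy)]; exact hfix
  rw [newton, sub_eq_self] at h1
  simpa using h1

end IsEstimatingFunction

end Estimating

/-! ### Consistency and asymptotic linearity -/

section Asymptotics

variable {Ω 𝒳 : Type*} [MeasurableSpace Ω] [MeasurableSpace 𝒳] {μ : Measure Ω}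
  {X : ℕ → Ω → 𝒳} {P : Measure 𝒳} {p : ℕ}
  {g : Param p → 𝒳 → Param p} {θ₀ : Param p} {δ : ℝ} {G : Set 𝒳}
  {D : 𝒳 → Param p →L[ℝ] Param p} {B : 𝒳 → ℝ} {A : Param p ≃L[ℝ] Param p}

theorem eventually_sample_mem (hX : ∀ i, Measurable (X i)) (hlaw : ∀ i, μ.map (X i) = P)
    (hG : ∀ᵐ x ∂P, x ∈ G) :
    ∀ᶠ q in inProb μ, ∀ i, sample X q.1 q.2 i ∈ G := by
  refine eventually_inProb_of_ae ?_
  have : ∀ᵐ ω ∂μ, ∀ i, X i ω ∈ G := ae_all_iff.2 fun i =>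
    ae_of_ae_map (hX i).aemeasurable (by rw [hlaw i]; exact hG)
  filter_upwards [this] with ω hω n i using hω i

variable [IsProbabilityMeasure μ]

/-- The estimating equation has, with probability tending to one, a root that is a measurable
function of the sample and that is consistent. -/
theorem IsEstimatingFunction.exists_consistent_root
    (hg : IsEstimatingFunction P g θ₀ δ G D B A) (hX : ∀ i, Measurable (X i))
    (hindep : iIndepFun X μ) (hlaw : ∀ i, μ.map (X i) = P) :
    ∃ T : (n : ℕ) → (Fin n → 𝒳) → Param p, (∀ n, Measurable (T n)) ∧
      (∀ n x, T n x ∈ Metric.closedBall θ₀ δ) ∧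
      (∀ᶠ q in inProb μ, average (g (T q.1 (sample X q.1 q.2))) (sample X q.1 q.2) = 0) ∧
      Tendsto (fun q : ℕ × Ω => T q.1 (sample X q.1 q.2)) (inProb μ) (𝓝 θ₀) := by
  set c : ℝ := ‖(A.symm : Param p →L[ℝ] Param p)‖ with hc
  set b : ℝ := ∫ x, B x ∂P with hb
  have hB : Tendsto (fun q : ℕ × Ω => average B (sample X q.1 q.2)) (inProb μ) (𝓝 b) :=
    tendsto_average_inProb hX hindep hlaw hg.integrable_bound
  have hD : Tendsto (fun q : ℕ × Ω => average D (sample X q.1 q.2)) (inProb μ)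
      (𝓝 (A : Param p →L[ℝ] Param p)) := by
    rw [← hg.integral_deriv]
    exact tendsto_average_inProb hX hindep hlaw hg.integrable_deriv
  have hΨ : Tendsto (fun q : ℕ × Ω => average (g θ₀) (sample X q.1 q.2)) (inProb μ) (𝓝 0) := by
    rw [← hg.integral_eq_zero]
    exact tendsto_average_inProb hX hindep hlaw hg.integrable
  -- the radius is chosen so that `c * (b * ρ) < 1 / 2`
  obtain ⟨ρ, hρ, hρδ, hρc⟩ : ∃ ρ, 0 < ρ ∧ ρ ≤ δ ∧ c * (b * ρ) < 1 / 2 := by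
    have : Tendsto (fun ρ : ℝ => c * (b * ρ)) (𝓝[>] 0) (𝓝 (c * (b * 0))) :=
      (Continuous.tendsto (by fun_prop) 0).mono_left nhdsWithin_le_nhds
    rw [mul_zero, mul_zero] at this
    have h1 := this.eventually (gt_mem_nhds (by norm_num : (0 : ℝ) < 1 / 2))
    have h2 : ∀ᶠ ρ : ℝ in 𝓝[>] 0, ρ ∈ Set.Ioc 0 δ := Ioc_mem_nhdsGT hg.pos
    obtain ⟨ρ, h1, h2⟩ := (h1.and h2).exists
    exact ⟨ρ, h2.1, h2.2, h1⟩
  have hcontr : ∀ᶠ q in inProb μ, c * (‖average D (sample X q.1 q.2) -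
      (A : Param p →L[ℝ] Param p)‖ + average B (sample X q.1 q.2) * ρ) ≤ 1 / 2 := by
    have h1 : Tendsto (fun q : ℕ × Ω => c * (‖average D (sample X q.1 q.2) -
        (A : Param p →L[ℝ] Param p)‖ + average B (sample X q.1 q.2) * ρ)) (inProb μ)
        (𝓝 (c * (0 + b * ρ))) :=
      (((tendsto_iff_norm_sub_tendsto_zero.1 hD).add (hB.mul_const ρ)).const_mul c)
    rw [zero_add] at h1
    exact (h1.eventually (gt_mem_nhds hρc)).mono fun q hq => hq.le
  have hsmall : ∀ η > 0, ∀ᶠ q in inProb μ,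
      ‖A.symm (average (g θ₀) (sample X q.1 q.2))‖ ≤ η := fun η hη => by
    have h1 := ((A.symm.continuous.tendsto 0).comp hΨ).norm
    rw [map_zero, norm_zero] at h1
    exact (h1.eventually (gt_mem_nhds hη)).mono fun q hq => hq.le
  have hmem := eventually_sample_mem (G := G) hX hlaw hg.ae_mem
  have hspec : ∀ η > 0, 2 * η ≤ ρ → ∀ᶠ q in inProb μ,
      newtonLimit g A G θ₀ ρ q.1 (sample X q.1 q.2) ∈ Metric.closedBall θ₀ (2 * η) ∧
      average (g (newtonLimit g A G θ₀ ρ q.1 (sample X q.1 q.2))) (sample X q.1 q.2) = 0 :=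
    fun η hη hηρ => by
      filter_upwards [hcontr, hsmall η hη, hmem] with q h1 h2 h3
      exact hg.newtonLimit_spec hρ hρδ h3 h1 hηρ h2
  refine ⟨newtonLimit g A G θ₀ ρ, hg.measurable_newtonLimit hρ hρδ, fun n x => ?_, ?_, ?_⟩
  · exact Metric.closedBall_subset_closedBall hρδ (retract_mem hρ _)
  · exact (hspec (ρ / 2) (by positivity) (by linarith)).mono fun q hq => hq.2
  · rw [Metric.tendsto_nhds]
    intro ε hε
    have hη : 0 < min (ρ / 2) (ε / 4) := by positivity
    filter_upwards [hspec _ hη (by linarith [min_le_left (ρ / 2) (ε / 4)])] with q hq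
    have := Metric.mem_closedBall.1 hq.1
    linarith [min_le_right (ρ / 2) (ε / 4)]

/-- A consistent root of the estimating equation is asymptotically linear: its deviation from `θ₀`
is `-A⁻¹ Ψ_n(θ₀)`, up to a term that is negligible with respect to `n ^ (-1/2)`. -/
theorem IsEstimatingFunction.asymptotically_linear
    (hg : IsEstimatingFunction P g θ₀ δ G D B A) (hX : ∀ i, Measurable (X i))
    (hindep : iIndepFun X μ) (hlaw : ∀ i, μ.map (X i) = P)
    (hL2 : MemLp (g θ₀) 2 P) {S : Matrix (Fin p) (Fin p) ℝ} (hS : S.PosSemidef)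
    (hcov : ∀ j k, ∫ x, g θ₀ x j * g θ₀ x k ∂P = S j k)
    {T : ℕ × Ω → Param p} (hT : Tendsto T (inProb μ) (𝓝 θ₀))
    (hroot : ∀ᶠ q in inProb μ, average (g (T q)) (sample X q.1 q.2) = 0) :
    Tendsto (fun q : ℕ × Ω => √q.1 * ‖T q - θ₀ + A.symm (average (g θ₀) (sample X q.1 q.2))‖)
      (inProb μ) (𝓝 0) := by
  set c : ℝ := ‖(A.symm : Param p →L[ℝ] Param p)‖ with hc
  have hB : Tendsto (fun q : ℕ × Ω => average B (sample X q.1 q.2)) (inProb μ)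
      (𝓝 (∫ x, B x ∂P)) :=
    tendsto_average_inProb hX hindep hlaw hg.integrable_bound
  have hD : Tendsto (fun q : ℕ × Ω => average D (sample X q.1 q.2)) (inProb μ)
      (𝓝 (A : Param p →L[ℝ] Param p)) := by
    rw [← hg.integral_deriv]
    exact tendsto_average_inProb hX hindep hlaw hg.integrable_deriv
  have hTn : Tendsto (fun q => ‖T q - θ₀‖) (inProb μ) (𝓝 0) :=
    tendsto_iff_norm_sub_tendsto_zero.1 hT
  -- the relative error of the linearization
  set ε : ℕ × Ω → ℝ := fun q => c * (‖average D (sample X q.1 q.2) -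
      (A : Param p →L[ℝ] Param p)‖ + average B (sample X q.1 q.2) * ‖T q - θ₀‖) with hεdef
  have hε : Tendsto ε (inProb μ) (𝓝 0) := by
    have h1 : Tendsto ε (inProb μ) (𝓝 (c * (0 + (∫ x, B x ∂P) * 0))) :=
      ((tendsto_iff_norm_sub_tendsto_zero.1 hD).add (hB.mul hTn)).const_mul c
    simpa using h1
  have hclt := tendstoInDistribution_multivariate_clt hX hindep hlaw hL2 hg.integral_eq_zero hS hcov
  have hprod := tendsto_mul_norm_inProb hclt
    (r := fun q => 2 * c * ε q) (by simpa using hε.const_mul (2 * c))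
  refine squeeze_zero' (Eventually.of_forall fun q => by positivity) ?_ hprod
  have hsmall : ∀ᶠ q in inProb μ, ε q < 1 / 2 := hε.eventually (gt_mem_nhds (by norm_num))
  have hball : ∀ᶠ q in inProb μ, T q ∈ Metric.closedBall θ₀ δ :=
    hT.eventually (Metric.closedBall_mem_nhds θ₀ hg.pos)
  filter_upwards [hsmall, hball, hroot, eventually_sample_mem (G := G) hX hlaw hg.ae_mem,
    tendsto_fst_inProb.eventually (eventually_gt_atTop 0)] with q h1 h2 h3 h4 h5
  set x := sample X q.1 q.2 with hx
  set s := A.symm (average (g θ₀) x) with hs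
  have hkey := hg.norm_newton_sub_le h4 (mem_closedBall_iff_norm.1 h2)
    (mem_closedBall_iff_norm.2 le_rfl) (Metric.mem_closedBall_self (norm_nonneg _))
  have e1 : IsEstimatingFunction.newton g A x (T q) - IsEstimatingFunction.newton g A x θ₀
      = T q - θ₀ + s := by
    rw [IsEstimatingFunction.newton, IsEstimatingFunction.newton, h3, map_zero]
    abel
  rw [e1] at hkey
  change ‖T q - θ₀ + s‖ ≤ ε q * ‖T q - θ₀‖ at hkey
  have hεnn : 0 ≤ ε q := by
    by_contra hneg
    push Not at hneg
    by_cases hz : ‖T q - θ₀‖ = 0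
    · simp only [hεdef, hz, mul_zero, add_zero] at hneg
      exact absurd hneg (not_lt.2 (by positivity))
    · have : 0 < ‖T q - θ₀‖ := lt_of_le_of_ne (norm_nonneg _) (Ne.symm hz)
      nlinarith [norm_nonneg (T q - θ₀ + s)]
  have htri : ‖T q - θ₀‖ ≤ ‖T q - θ₀ + s‖ + ‖s‖ := by
    simpa using norm_sub_le (T q - θ₀ + s) s
  have h6 : ‖T q - θ₀ + s‖ ≤ 2 * ε q * ‖s‖ := by nlinarith [norm_nonneg (T q - θ₀ + s)]
  have h7 : ‖s‖ ≤ c * ‖average (g θ₀) x‖ :=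
    ContinuousLinearMap.le_opNorm (A.symm : Param p →L[ℝ] Param p) _
  have hn : (0 : ℝ) < q.1 := by exact_mod_cast h5
  have h8 : √q.1 * ‖average (g θ₀) x‖ = ‖(√q.1)⁻¹ • ∑ i : Fin q.1, g θ₀ (X i q.2)‖ := by
    rw [average, norm_smul, norm_smul, Real.norm_of_nonneg (by positivity),
      Real.norm_of_nonneg (by positivity), ← mul_assoc]
    congr 1
    rw [← Real.sqrt_div_self, div_eq_mul_inv]
  calc √q.1 * ‖T q - θ₀ + s‖ ≤ √q.1 * (2 * ε q * (c * ‖average (g θ₀) x‖)) := by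
        gcongr
        exact h6.trans (by gcongr)
    _ = 2 * c * ε q * (√q.1 * ‖average (g θ₀) x‖) := by ring
    _ = _ := by rw [h8]

end Asymptotics

/-! ### Quadratic forms in asymptotically linear estimators -/

section Quadratic

open scoped RealInnerProductSpace

variable {Ω 𝒳 : Type*} [MeasurableSpace Ω] [MeasurableSpace 𝒳] {μ : Measure Ω}
  [IsProbabilityMeasure μ] {X : ℕ → Ω → 𝒳} {P : Measure 𝒳} {p r : ℕ}
  {g : Param p → 𝒳 → Param p} {θ₀ : Param p} {δ : ℝ} {G : Set 𝒳}
  {D : 𝒳 → Param p →L[ℝ] Param p} {B : 𝒳 → ℝ} {A : Param p ≃L[ℝ] Param p}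

theorem abs_quadratic_sub_le {F : Type*} [NormedAddCommGroup F] [InnerProductSpace ℝ F]
    (N N₀ : F →L[ℝ] F) (v w : F) :
    |⟪v, N v⟫ - ⟪w, N₀ w⟫| ≤
      ‖N - N₀‖ * ‖w‖ * ‖w‖ + ‖v - w‖ * ‖N‖ * (2 * ‖w‖) + ‖v - w‖ * ‖N‖ * ‖v - w‖ := by
  obtain ⟨e, rfl⟩ : ∃ e, v = w + e := ⟨v - w, by abel⟩
  rw [add_sub_cancel_left]
  have key : ⟪w + e, N (w + e)⟫ - ⟪w, N₀ w⟫ =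
      ⟪w, (N - N₀) w⟫ + (⟪e, N w⟫ + ⟪w, N e⟫) + ⟪e, N e⟫ := by
    simp only [map_add, inner_add_left, inner_add_right, _root_.sub_apply, inner_sub_right]
    ring
  have hb : ∀ (L : F →L[ℝ] F) (a b : F), |⟪a, L b⟫| ≤ ‖a‖ * (‖L‖ * ‖b‖) := fun L a b =>
    (abs_real_inner_le_norm _ _).trans (by gcongr; exact L.le_opNorm b)
  rw [key]
  calc _ ≤ |⟪w, (N - N₀) w⟫| + (|⟪e, N w⟫| + |⟪w, N e⟫|) + |⟪e, N e⟫| :=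
        (abs_add_le _ _).trans (add_le_add_left ((abs_add_le _ _).trans
          (add_le_add_right (abs_add_le _ _) _)) _)
    _ ≤ ‖w‖ * (‖N - N₀‖ * ‖w‖) + (‖e‖ * (‖N‖ * ‖w‖) + ‖w‖ * (‖N‖ * ‖e‖)) + ‖e‖ * (‖N‖ * ‖e‖) := by
        gcongr <;> exact hb _ _ _
    _ = _ := by ring

/-- Let `T` be a consistent root of the estimating equation, `m` a map that vanishes at `θ₀` and is
differentiable there, and `N` a continuous family of quadratic forms. If `N θ₀ = RᵀR`, where `R`
standardizes the influence function of `m (T)`, then `n ⟪m (T), N (T) m (T)⟫` is asymptotically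
distributed as a chi-square variable. -/
theorem IsEstimatingFunction.tendstoInDistribution_quadratic
    (hg : IsEstimatingFunction P g θ₀ δ G D B A) (hX : ∀ i, Measurable (X i))
    (hindep : iIndepFun X μ) (hlaw : ∀ i, μ.map (X i) = P)
    (hL2 : MemLp (g θ₀) 2 P) {S : Matrix (Fin p) (Fin p) ℝ} (hS : S.PosSemidef)
    (hcov : ∀ j k, ∫ x, g θ₀ x j * g θ₀ x k ∂P = S j k)
    {T : ℕ → Ω → Param p} (hT : Tendsto (fun q : ℕ × Ω => T q.1 q.2) (inProb μ) (𝓝 θ₀))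
    (hroot : ∀ᶠ q in inProb μ, average (g (T q.1 q.2)) (sample X q.1 q.2) = 0)
    {m : Param p → EuclideanSpace ℝ (Fin r)} {M : Param p →L[ℝ] EuclideanSpace ℝ (Fin r)}
    (hm0 : m θ₀ = 0) (hm : HasFDerivAt m M θ₀)
    {N : Param p → EuclideanSpace ℝ (Fin r) →L[ℝ] EuclideanSpace ℝ (Fin r)}
    (hN : ContinuousAt N θ₀) {R : EuclideanSpace ℝ (Fin r) →L[ℝ] EuclideanSpace ℝ (Fin r)}
    (hR : ∀ v, ⟪v, N θ₀ v⟫ = ‖R v‖ ^ 2)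
    (hstd : ∀ j k, ∫ x, R (M (A.symm (g θ₀ x))) j * R (M (A.symm (g θ₀ x))) k ∂P
      = (1 : Matrix (Fin r) (Fin r) ℝ) j k)
    (hW : ∀ n : ℕ, AEMeasurable (fun ω => n * ⟪m (T n ω), N (T n ω) (m (T n ω))⟫) μ) :
    TendstoInDistribution (fun (n : ℕ) ω => n * ⟪m (T n ω), N (T n ω) (m (T n ω))⟫) atTop
      (fun x : ℝ => x) (fun _ => μ) (chiSquare r) := by
  -- the influence function of `m (T)`, standardized
  set H : Param p →L[ℝ] EuclideanSpace ℝ (Fin r) :=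
    M ∘L (A.symm : Param p →L[ℝ] Param p) with hH
  have hhL2 : MemLp (fun x => (R ∘L H) (g θ₀ x)) 2 P := hL2.continuousLinearMap_comp (R ∘L H)
  have hPp : IsProbabilityMeasure P := by
    rw [← hlaw 0]; exact Measure.isProbabilityMeasure_map (hX 0).aemeasurable
  have hh0 : ∫ x, (R ∘L H) (g θ₀ x) ∂P = 0 := by
    rw [ContinuousLinearMap.integral_comp_comm _ hg.integrable, hg.integral_eq_zero, map_zero]
  have hcltZ := tendstoInDistribution_multivariate_clt hX hindep hlaw hhL2 hh0
    Matrix.PosSemidef.one hstd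
  have hclt := tendstoInDistribution_multivariate_clt hX hindep hlaw hL2 hg.integral_eq_zero hS hcov
  have hchi := hcltZ.continuous_comp (g := fun z => ‖z‖ ^ 2) (by fun_prop)
  have hchi' : TendstoInDistribution (fun (n : ℕ) ω =>
      ‖(√n)⁻¹ • ∑ i : Fin n, (R ∘L H) (g θ₀ (X i ω))‖ ^ 2) atTop (fun x : ℝ => x)
      (fun _ => μ) (chiSquare r) := by
    refine ⟨hchi.forall_aemeasurable, aemeasurable_id, ?_⟩
    have hlim : (chiSquare r).map (fun x => x)
        = (multivariateGaussian 0 1).map ((fun z : EuclideanSpace ℝ (Fin r) => ‖z‖ ^ 2) ∘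
          fun z => z) := by
      rw [Measure.map_id', ← map_multivariateGaussian_norm_sq]
      rfl
    simp only [hlim]
    exact hchi.tendsto
  refine tendstoInDistribution_of_tendstoInMeasure_sub _ _ hchi' ?_ hW
  change TendstoInMeasure μ _ atTop (fun _ => 0)
  rw [tendstoInMeasure_iff_tendsto_inProb]
  set Y : ℕ → Ω → Param p := fun n ω => (√n)⁻¹ • ∑ i : Fin n, g θ₀ (X i ω) with hY
  have hlin := hg.asymptotically_linear hX hindep hlaw hL2 hS hcov hT hroot
  set c : ℝ := ‖(A.symm : Param p →L[ℝ] Param p)‖ with hc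
  set d : ℕ × Ω → ℝ := fun q => √q.1 * ‖T q.1 q.2 - θ₀ +
    A.symm (average (g θ₀) (sample X q.1 q.2))‖ with hd
  set φ : Param p → ℝ := fun θ => ‖θ - θ₀‖⁻¹ * ‖m θ - m θ₀ - M (θ - θ₀)‖ with hφ
  have hφ0 : Tendsto (fun q : ℕ × Ω => φ (T q.1 q.2)) (inProb μ) (𝓝 0) :=
    (hasFDerivAt_iff_tendsto.1 hm).comp hT
  have hYavg : ∀ q : ℕ × Ω, √q.1 • average (g θ₀) (sample X q.1 q.2) = Y q.1 q.2 := fun q => by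
    rw [average, smul_smul, ← div_eq_mul_inv, Real.sqrt_div_self]
    rfl
  -- `m (T)` is asymptotically linear
  set w : ℕ × Ω → EuclideanSpace ℝ (Fin r) := fun q => - H (Y q.1 q.2) with hw
  set v : ℕ × Ω → EuclideanSpace ℝ (Fin r) := fun q => √q.1 • m (T q.1 q.2) with hv
  have he : Tendsto (fun q => ‖v q - w q‖) (inProb μ) (𝓝 0) := by
    have hbound : Tendsto (fun q => φ (T q.1 q.2) * d q + φ (T q.1 q.2) * c * ‖Y q.1 q.2‖
        + ‖M‖ * d q) (inProb μ) (𝓝 0) := by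
      have h1 := tendsto_mul_norm_inProb hclt (r := fun q => φ (T q.1 q.2) * c)
        (by simpa using hφ0.mul_const c)
      simpa using ((hφ0.mul hlin).add h1).add (hlin.const_mul ‖M‖)
    refine squeeze_zero (fun _ => norm_nonneg _) (fun q => ?_) hbound
    set t := T q.1 q.2 - θ₀ with ht
    set s := A.symm (average (g θ₀) (sample X q.1 q.2)) with hs
    have e1 : v q - w q = √q.1 • (m (T q.1 q.2) - m θ₀ - M t) + √q.1 • M (t + s) := by
      have : H (Y q.1 q.2) = √q.1 • M s := by
        rw [← hYavg q, map_smul]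
        rfl
      simp only [hv, hw, this, hm0, map_add, smul_add, smul_sub, sub_zero]
      abel
    have e2 : ‖m (T q.1 q.2) - m θ₀ - M t‖ = φ (T q.1 q.2) * ‖t‖ := by
      by_cases hz : ‖t‖ = 0
      · have hz' : T q.1 q.2 = θ₀ := sub_eq_zero.1 (norm_eq_zero.1 hz)
        have hz'' : t = 0 := norm_eq_zero.1 hz
        rw [hz'', hz']
        simp
      · rw [hφ]
        simp only [← ht]
        field_simp
    have e3 : √q.1 * ‖t‖ ≤ d q + c * ‖Y q.1 q.2‖ := by
      have h1 : ‖t‖ ≤ ‖t + s‖ + ‖s‖ := by simpa using norm_sub_le (t + s) s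
      have h2 : √q.1 * ‖s‖ ≤ c * ‖Y q.1 q.2‖ := by
        have : √q.1 • s = A.symm (Y q.1 q.2) := by rw [← hYavg q, map_smul]
        calc √q.1 * ‖s‖ = ‖√q.1 • s‖ := by rw [norm_smul, Real.norm_of_nonneg (by positivity)]
          _ ≤ _ := by
            rw [this]
            exact ContinuousLinearMap.le_opNorm (A.symm : Param p →L[ℝ] Param p) _
      calc √q.1 * ‖t‖ ≤ √q.1 * (‖t + s‖ + ‖s‖) := by gcongr
        _ ≤ _ := by rw [mul_add]; exact add_le_add le_rfl h2
    have hφnn : 0 ≤ φ (T q.1 q.2) := by rw [hφ]; positivity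
    rw [e1]
    calc _ ≤ √q.1 * (φ (T q.1 q.2) * ‖t‖) + √q.1 * (‖M‖ * ‖t + s‖) := by
          refine (norm_add_le _ _).trans ?_
          rw [norm_smul, norm_smul, Real.norm_of_nonneg (by positivity : (0 : ℝ) ≤ √q.1), e2]
          gcongr
          exact M.le_opNorm _
      _ = φ (T q.1 q.2) * (√q.1 * ‖t‖) + ‖M‖ * d q := by rw [hd]; ring
      _ ≤ φ (T q.1 q.2) * (d q + c * ‖Y q.1 q.2‖) + ‖M‖ * d q := by gcongr
      _ = _ := by ring
  have hwY : ∀ q, ‖w q‖ ≤ ‖H‖ * ‖Y q.1 q.2‖ := fun q => by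
    rw [hw]
    simp only [norm_neg]
    exact H.le_opNorm _
  have hNT : Tendsto (fun q : ℕ × Ω => N (T q.1 q.2)) (inProb μ) (𝓝 (N θ₀)) := hN.tendsto.comp hT
  have hNd : Tendsto (fun q : ℕ × Ω => ‖N (T q.1 q.2) - N θ₀‖) (inProb μ) (𝓝 0) :=
    tendsto_iff_norm_sub_tendsto_zero.1 hNT
  have heN : Tendsto (fun q => ‖v q - w q‖ * ‖N (T q.1 q.2)‖) (inProb μ) (𝓝 0) := by
    simpa using he.mul hNT.norm
  have hbound : Tendsto (fun q =>
      ‖N (T q.1 q.2) - N θ₀‖ * (‖H‖ * ‖Y q.1 q.2‖) * (‖H‖ * ‖Y q.1 q.2‖)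
      + ‖v q - w q‖ * ‖N (T q.1 q.2)‖ * (2 * (‖H‖ * ‖Y q.1 q.2‖))
      + ‖v q - w q‖ * ‖N (T q.1 q.2)‖ * ‖v q - w q‖) (inProb μ) (𝓝 0) := by
    have h1 := tendsto_mul_norm_inProb hclt
      (r := fun q => ‖N (T q.1 q.2) - N θ₀‖ * (‖H‖ * ‖H‖))
      (by simpa using hNd.mul_const (‖H‖ * ‖H‖))
    have h2 := tendsto_mul_norm_inProb hclt h1
    have h3 := tendsto_mul_norm_inProb hclt
      (r := fun q => ‖v q - w q‖ * ‖N (T q.1 q.2)‖ * (2 * ‖H‖))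
      (by simpa using heN.mul_const (2 * ‖H‖))
    have h4 := (h2.add h3).add (heN.mul he)
    simp only [mul_zero, add_zero] at h4
    refine h4.congr fun q => ?_
    simp only [hY]
    ring
  refine squeeze_zero_norm (fun q => ?_) hbound
  have e1 : (q.1 : ℝ) * ⟪m (T q.1 q.2), N (T q.1 q.2) (m (T q.1 q.2))⟫
      = ⟪v q, N (T q.1 q.2) (v q)⟫ := by
    simp only [hv, map_smul, real_inner_smul_left, real_inner_smul_right]
    rw [← mul_assoc, Real.mul_self_sqrt (by positivity)]
  have e2 : ‖(√q.1)⁻¹ • ∑ i : Fin q.1, (R ∘L H) (g θ₀ (X i q.2))‖ ^ 2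
      = ⟪w q, N θ₀ (w q)⟫ := by
    rw [hR]
    simp only [hw, hY, map_neg, norm_neg, map_smul, map_sum, ContinuousLinearMap.comp_apply]
  rw [Pi.sub_apply, Pi.sub_apply, e1, e2, Real.norm_eq_abs]
  refine (abs_quadratic_sub_le _ _ _ _).trans ?_
  gcongr <;> exact hwY q

end Quadratic

/-! ### Partial derivatives -/

section Partial

variable {p : ℕ} {U : Set (Param p)} {F F' : Param p → ℝ} {θ θ₀ : Param p}

theorem partialD_congr (h : F =ᶠ[𝓝 θ] F') (j : Fin p) : partialD j F θ = partialD j F' θ := by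
  rw [partialD, partialD, h.fderiv_eq]

theorem iterPartial_congr (hU : IsOpen U) (h : Set.EqOn F F' U) (L : List (Fin p)) :
    Set.EqOn (iterPartial L F) (iterPartial L F') U := by
  induction L with
  | nil => exact h
  | cons j L ih =>
    intro θ hθ
    exact partialD_congr (ih.eventuallyEq_of_mem (hU.mem_nhds hθ)) j

theorem partialD_add (h : DifferentiableAt ℝ F θ) (h' : DifferentiableAt ℝ F' θ) (j : Fin p) :
    partialD j (fun t => F t + F' t) θ = partialD j F θ + partialD j F' θ := by
  rw [partialD, fderiv_fun_add h h', _root_.add_apply]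
  rfl

theorem partialD_const_mul (c : ℝ) (h : DifferentiableAt ℝ F θ) (j : Fin p) :
    partialD j (fun t => c * F t) θ = c * partialD j F θ := by
  rw [partialD, fderiv_const_mul h, _root_.smul_apply]
  rfl

theorem partialD_mul (h : DifferentiableAt ℝ F θ) (h' : DifferentiableAt ℝ F' θ) (j : Fin p) :
    partialD j (fun t => F t * F' t) θ = F θ * partialD j F' θ + F' θ * partialD j F θ := by
  rw [partialD, fderiv_fun_mul h h', _root_.add_apply, _root_.smul_apply, _root_.smul_apply]
  rfl

theorem contDiffOn_partialD (hU : IsOpen U) {n : ℕ} (h : ContDiffOn ℝ (n + 1) F U) (j : Fin p) :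
    ContDiffOn ℝ n (partialD j F) U :=
  (h.fderiv_of_isOpen hU le_rfl).clm_apply contDiffOn_const

theorem differentiableOn_iterPartial (hU : IsOpen U) {n : ℕ} (h : ContDiffOn ℝ n F U)
    (L : List (Fin p)) (hL : L.length < n) : DifferentiableOn ℝ (iterPartial L F) U := by
  have key : ∀ (L : List (Fin p)) (k : ℕ), L.length + k ≤ n →
      ContDiffOn ℝ k (iterPartial L F) U := fun L => by
    induction L with
    | nil => exact fun k hk => h.of_le (by simpa using hk)
    | cons j L ih =>
      intro k hk
      exact contDiffOn_partialD hU (by exact_mod_cast ih (k + 1) (by simp at hk; omega)) j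
  exact (key L 1 hL).differentiableOn (by simp)

theorem iterPartial_add (hU : IsOpen U) {n : ℕ}
    (h : ∀ L : List (Fin p), L.length < n → DifferentiableOn ℝ (iterPartial L F) U)
    (h' : ∀ L : List (Fin p), L.length < n → DifferentiableOn ℝ (iterPartial L F') U)
    (L : List (Fin p)) (hL : L.length ≤ n) :
    Set.EqOn (iterPartial L fun t => F t + F' t) (fun t => iterPartial L F t + iterPartial L F' t)
      U := by
  induction L with
  | nil => exact fun _ _ => rfl
  | cons j L ih =>
    intro θ hθ
    have hL' : L.length < n := by simpa using hL
    have hθU := hU.mem_nhds hθ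
    change partialD j (iterPartial L fun t => F t + F' t) θ = _
    rw [partialD_congr ((ih hL'.le).eventuallyEq_of_mem hθU),
      partialD_add ((h L hL').differentiableAt hθU) ((h' L hL').differentiableAt hθU)]
    rfl

theorem dual_apply_eq_sum (L : Param p →L[ℝ] ℝ) (v : Param p) :
    L v = ∑ j, L (EuclideanSpace.single j 1) * v j := by
  conv_lhs => rw [← (EuclideanSpace.basisFun (Fin p) ℝ).sum_repr v]
  simp [mul_comm]

theorem norm_le_sum_abs (v : Param p) : ‖v‖ ≤ ∑ j, |v j| := by
  conv_lhs => rw [← (EuclideanSpace.basisFun (Fin p) ℝ).sum_repr v]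
  refine (norm_sum_le _ _).trans (Finset.sum_le_sum fun j _ => ?_)
  simp [norm_smul]

theorem norm_dual_le_sum (L : Param p →L[ℝ] ℝ) :
    ‖L‖ ≤ ∑ j, |L (EuclideanSpace.single j 1)| := by
  refine L.opNorm_le_bound (Finset.sum_nonneg fun _ _ => abs_nonneg _) fun v => ?_
  rw [dual_apply_eq_sum L v, Finset.sum_mul]
  refine (norm_sum_le _ _).trans (Finset.sum_le_sum fun j _ => ?_)
  rw [norm_mul, Real.norm_eq_abs]
  gcongr
  exact PiLp.norm_apply_le v j

/-- First-order Taylor estimate: if the second derivatives are bounded, then on a ball of radius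
`ρ` the increments of `F` differ from those of its derivative at the centre by `O(ρ)`, relatively
to the size of the increment of the argument. -/
theorem abs_sub_sub_fderiv_le (hU : IsOpen U) {δ : ℝ} (hδ : Metric.closedBall θ₀ δ ⊆ U)
    (hF : DifferentiableOn ℝ F U) (hF' : ∀ k, DifferentiableOn ℝ (partialD k F) U)
    {b : Fin p → Fin p → ℝ} (hb : ∀ θ ∈ U, ∀ k l, |partialD l (partialD k F) θ| ≤ b k l)
    {ρ : ℝ} (hρ : ρ ≤ δ) {θ θ' : Param p} (hθ : θ ∈ Metric.closedBall θ₀ ρ)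
    (hθ' : θ' ∈ Metric.closedBall θ₀ ρ) :
    |F θ - F θ' - fderiv ℝ F θ₀ (θ - θ')| ≤ (∑ k, ∑ l, b k l) * ρ * ‖θ - θ'‖ := by
  have hsub : Metric.closedBall θ₀ ρ ⊆ U := (Metric.closedBall_subset_closedBall hρ).trans hδ
  have hρ0 : 0 ≤ ρ := dist_nonneg.trans (Metric.mem_closedBall.1 hθ)
  have h0 : θ₀ ∈ Metric.closedBall θ₀ ρ := Metric.mem_closedBall_self hρ0
  have hpart : ∀ k, ∀ t ∈ Metric.closedBall θ₀ ρ,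
      |partialD k F t - partialD k F θ₀| ≤ (∑ l, b k l) * ρ := fun k t ht => by
    have h1 := (convex_closedBall θ₀ ρ).norm_image_sub_le_of_norm_fderiv_le (𝕜 := ℝ)
      (f := partialD k F) (C := ∑ l, b k l)
      (fun s hs => (hF' k).differentiableAt (hU.mem_nhds (hsub hs)))
      (fun s hs => (norm_dual_le_sum _).trans
        (Finset.sum_le_sum fun l _ => hb s (hsub hs) k l)) h0 ht
    rw [← Real.norm_eq_abs]
    refine h1.trans ?_
    have : 0 ≤ ∑ l, b k l :=
      Finset.sum_nonneg fun l _ => (abs_nonneg _).trans (hb θ₀ (hsub h0) k l)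
    gcongr
    exact mem_closedBall_iff_norm.1 ht
  have h2 := (convex_closedBall θ₀ ρ).norm_image_sub_le_of_norm_fderiv_le' (𝕜 := ℝ)
    (f := F) (φ := fderiv ℝ F θ₀) (C := (∑ k, ∑ l, b k l) * ρ)
    (fun s hs => hF.differentiableAt (hU.mem_nhds (hsub hs)))
    (fun s hs => by
      refine (norm_dual_le_sum _).trans ?_
      rw [Finset.sum_mul]
      exact Finset.sum_le_sum fun k _ => hpart k s hs) hθ' hθ
  exact h2

end Partial

/-! ### Derivatives of the powers of a density -/

section Density

variable {p : ℕ} {𝒳 : Type*} {f : Param p → 𝒳 → ℝ} {Θ U : Set (Param p)} {x : 𝒳}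

/-- The density is positive at `x`, and three times continuously differentiable in the parameter. -/
structure IsSmoothPoint (f : Param p → 𝒳 → ℝ) (Θ U : Set (Param p)) (x : 𝒳) : Prop where
  isOpen : IsOpen U
  subset : U ⊆ Θ
  smooth : ContDiffOn ℝ 3 (fun θ => f θ x) U
  pos : ∀ θ ∈ Θ, 0 < f θ x

namespace IsSmoothPoint

theorem differentiableAt (h : IsSmoothPoint f Θ U x) {θ : Param p} (hθ : θ ∈ U) :
    DifferentiableAt ℝ (fun t => f t x) θ :=
  (h.smooth.differentiableOn (by simp)).differentiableAt (h.isOpen.mem_nhds hθ)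

theorem ne_zero (h : IsSmoothPoint f Θ U x) {θ : Param p} (hθ : θ ∈ U) : f θ x ≠ 0 :=
  (h.pos θ (h.subset hθ)).ne'

theorem contDiffOn_log (h : IsSmoothPoint f Θ U x) :
    ContDiffOn ℝ 3 (fun θ => Real.log (f θ x)) U :=
  h.smooth.log fun _ hθ => h.ne_zero hθ

theorem contDiffOn_rpow (h : IsSmoothPoint f Θ U x) (s : ℝ) :
    ContDiffOn ℝ 3 (fun θ => f θ x ^ s) U :=
  h.smooth.rpow_const_of_ne fun _ hθ => h.ne_zero hθ

theorem differentiableAt_score (h : IsSmoothPoint f Θ U x) {θ : Param p} (hθ : θ ∈ U)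
    (j : Fin p) : DifferentiableAt ℝ (fun t => score f t x j) θ :=
  ((contDiffOn_partialD (n := 2) h.isOpen (by exact_mod_cast h.contDiffOn_log) j).differentiableOn
    (by simp)).differentiableAt (h.isOpen.mem_nhds hθ)

theorem partialD_rpow (h : IsSmoothPoint f Θ U x) (s : ℝ) {θ : Param p} (hθ : θ ∈ U)
    (j : Fin p) :
    partialD j (fun t => f t x ^ s) θ = s * (score f θ x j * f θ x ^ s) := by
  have hd := (h.differentiableAt hθ).hasFDerivAt
  have hpos := h.pos θ (h.subset hθ)
  rw [score, partialD, partialD, (hd.rpow_const (Or.inl hpos.ne')).fderiv,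
    (hd.log hpos.ne').fderiv, _root_.smul_apply, _root_.smul_apply, Real.rpow_sub_one hpos.ne']
  simp only [smul_eq_mul]
  field_simp

theorem partialD_partialD_rpow (h : IsSmoothPoint f Θ U x) (s : ℝ) {θ : Param p} (hθ : θ ∈ U)
    (j k : Fin p) :
    partialD k (partialD j fun t => f t x ^ s) θ =
      s * ((partialD k (fun t => score f t x j) θ + s * (score f θ x j * score f θ x k))
        * f θ x ^ s) := by
  have hU := h.isOpen.mem_nhds hθ
  have hr : DifferentiableAt ℝ (fun t => f t x ^ s) θ :=
    ((h.contDiffOn_rpow s).differentiableOn (by simp)).differentiableAt hU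
  have hs := h.differentiableAt_score hθ j
  have heq : partialD j (fun t => f t x ^ s) =ᶠ[𝓝 θ] fun t => s * (score f t x j * f t x ^ s) := by
    filter_upwards [hU] with t ht using h.partialD_rpow s ht j
  rw [partialD_congr heq, partialD_const_mul _ (hs.fun_mul hr), partialD_mul hs hr,
    h.partialD_rpow s hθ]
  ring

end IsSmoothPoint

theorem iterPartial_rpow_of_eq_zero (hU : IsOpen U) {s : ℝ} (hs : s ≠ 0)
    (hx : ∀ θ ∈ U, f θ x = 0) (L : List (Fin p)) {θ : Param p} (hθ : θ ∈ U) :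
    iterPartial L (fun t => f t x ^ s) θ = 0 := by
  have h1 : Set.EqOn (fun t => f t x ^ s) (fun _ => 0) U := fun t ht => by
    simp [hx t ht, Real.zero_rpow hs]
  rw [iterPartial_congr hU h1 L hθ]
  have : ∀ L : List (Fin p), iterPartial L (fun _ : Param p => (0 : ℝ)) = fun _ => 0 := fun L => by
    induction L with
    | nil => rfl
    | cons j L ih =>
      change partialD j (iterPartial L _) = _
      rw [ih]
      funext t
      simp [partialD]
  rw [this]

end Density

/-! ### The gradient of the objective function -/

section Objective

variable {p : ℕ} {𝒳 : Type*} [MeasurableSpace 𝒳] {ν : Measure 𝒳} {f : Param p → 𝒳 → ℝ}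
  {Θ U : Set (Param p)} {β : ℝ} {θ₀ : Param p}

theorem integrable_modelLaw_iff (hf : IsDensityFamily ν f Θ) (h₀ : θ₀ ∈ Θ) {h : 𝒳 → ℝ} :
    Integrable h (modelLaw ν f θ₀) ↔ Integrable (fun x => h x * f θ₀ x) ν := by
  rw [modelLaw, integrable_withDensity_iff_integrable_smul' (hf.measurable θ₀ h₀).ennreal_ofReal
    (Eventually.of_forall fun _ => ENNReal.ofReal_lt_top)]
  simp only [ENNReal.toReal_ofReal (hf.nonneg θ₀ h₀ _), smul_eq_mul, mul_comm]

theorem integral_modelLaw (hf : IsDensityFamily ν f Θ) (h₀ : θ₀ ∈ Θ) (h : 𝒳 → ℝ) :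
    ∫ x, h x ∂(modelLaw ν f θ₀) = ∫ x, h x * f θ₀ x ∂ν := by
  rw [modelLaw, integral_withDensity_eq_integral_toReal_smul
    (hf.measurable θ₀ h₀).ennreal_ofReal (Eventually.of_forall fun _ => ENNReal.ofReal_lt_top)]
  simp only [ENNReal.toReal_ofReal (hf.nonneg θ₀ h₀ _), smul_eq_mul, mul_comm]

theorem isProbabilityMeasure_modelLaw (hf : IsDensityFamily ν f Θ) (h₀ : θ₀ ∈ Θ) :
    IsProbabilityMeasure (modelLaw ν f θ₀) := by
  refine ⟨?_⟩
  rw [modelLaw, withDensity_apply _ MeasurableSet.univ, Measure.restrict_univ]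
  exact hf.mass_one θ₀ h₀

/-- Almost every point, for the dominating measure, is either a smooth point or off the common
support. -/
theorem ae_isSmoothPoint_or (hf : IsDensityFamily ν f Θ) (hreg : Regular ν f β Θ U θ₀) :
    ∀ᵐ x ∂ν, IsSmoothPoint f Θ U x ∨ ∀ θ ∈ Θ, f θ x = 0 := by
  have h₀ := hreg.subset hreg.mem
  obtain ⟨S, hS⟩ := hreg.common_support
  have h1 := (ae_withDensity_iff (hf.measurable θ₀ h₀).ennreal_ofReal).1 hreg.smooth
  filter_upwards [h1] with x hx
  by_cases hpos : 0 < f θ₀ x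
  · have hxS : x ∈ S := by rw [← hS θ₀ h₀]; exact hpos
    refine Or.inl ⟨hreg.isOpen, hreg.subset, hx (by simpa using hpos), fun θ hθ => ?_⟩
    rw [← hS θ hθ] at hxS
    exact hxS
  · refine Or.inr fun θ hθ => le_antisymm (not_lt.1 fun hc => hpos ?_) (hf.nonneg θ hθ x)
    have hxS : x ∈ S := by rw [← hS θ hθ]; exact hc
    rw [← hS θ₀ h₀] at hxS
    exact hxS

theorem ae_isSmoothPoint (hf : IsDensityFamily ν f Θ) (hreg : Regular ν f β Θ U θ₀) :
    ∀ᵐ x ∂(modelLaw ν f θ₀), IsSmoothPoint f Θ U x := by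
  have h₀ := hreg.subset hreg.mem
  refine (ae_withDensity_iff (hf.measurable θ₀ h₀).ennreal_ofReal).2 ?_
  filter_upwards [ae_isSmoothPoint_or hf hreg] with x hx hne
  refine hx.resolve_right fun h => hne ?_
  simp [h θ₀ h₀]

/-- `∫ f_θ^{1+β} dν`. -/
noncomputable def powerIntegral (ν : Measure 𝒳) (f : Param p → 𝒳 → ℝ) (β : ℝ) (θ : Param p) : ℝ :=
  ∫ y, f θ y ^ (1 + β) ∂ν

theorem iterPartial_powerIntegral (hreg : Regular ν f β Θ U θ₀) (L : List (Fin p))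
    (hL : L.length ≤ 3) : Set.EqOn (iterPartial L (powerIntegral ν f β))
      (fun θ => ∫ x, iterPartial L (fun t => f t x ^ (1 + β)) θ ∂ν) U := by
  induction L with
  | nil => exact fun _ _ => rfl
  | cons j L ih =>
    intro θ hθ
    have hL' : L.length < 3 := by simpa using hL
    change partialD j (iterPartial L (powerIntegral ν f β)) θ = _
    rw [partialD_congr ((ih hL'.le).eventuallyEq_of_mem (hreg.isOpen.mem_nhds hθ)),
      (hreg.diff_integral_model.2 L hL' θ hθ).2 j]

theorem differentiableOn_iterPartial_powerIntegral (hreg : Regular ν f β Θ U θ₀)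
    (L : List (Fin p)) (hL : L.length < 3) :
    DifferentiableOn ℝ (iterPartial L (powerIntegral ν f β)) U := by
  refine DifferentiableOn.congr (fun θ hθ => ?_) (iterPartial_powerIntegral hreg L hL.le)
  exact (hreg.diff_integral_model.2 L hL θ hθ).1.differentiableWithinAt

theorem partialD_powerIntegral (hβ : 0 ≤ β) (hf : IsDensityFamily ν f Θ)
    (hreg : Regular ν f β Θ U θ₀) {θ : Param p} (hθ : θ ∈ U) (j : Fin p) :
    partialD j (powerIntegral ν f β) θ =
      (1 + β) * ∫ y, score f θ y j * f θ y ^ (1 + β) ∂ν := by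
  have h1 := iterPartial_powerIntegral hreg [j] (by simp) hθ
  change partialD j (powerIntegral ν f β) θ = _ at h1
  rw [h1, ← integral_const_mul]
  refine integral_congr_ae ?_
  filter_upwards [ae_isSmoothPoint_or hf hreg] with x hx
  rcases hx with hx | hx
  · exact hx.partialD_rpow _ hθ j
  · have hs : (1 + β) ≠ 0 := by positivity
    rw [iterPartial_rpow_of_eq_zero hreg.isOpen hs (fun t ht => hx t (hreg.subset ht)) _ hθ,
      hx θ (hreg.subset hθ), Real.zero_rpow hs]
    ring

/-- On `U`, `V_θ(x)` is `∫ f_θ^{1+β} dν` plus a smooth function with an explicit gradient. -/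
theorem exists_V_eq (hβ : 0 ≤ β) (hf : IsDensityFamily ν f Θ) {x : 𝒳}
    (hx : IsSmoothPoint f Θ U x) :
    ∃ φ : Param p → ℝ, ContDiffOn ℝ 3 φ U ∧
      Set.EqOn (fun t => V ν f β t x) (fun t => powerIntegral ν f β t + φ t) U ∧
      ∀ j, Set.EqOn (partialD j φ) (fun t => -(1 + β) * (score f t x j * f t x ^ β)) U := by
  rcases hβ.eq_or_lt with rfl | hβ
  · refine ⟨fun t => -1 + -1 * Real.log (f t x),
      contDiffOn_const.add (contDiffOn_const.mul hx.contDiffOn_log), fun t ht => ?_,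
      fun j t ht => ?_⟩
    · have hmass : ∫ y, f t y ∂ν = 1 := by
        have htΘ := hx.subset ht
        rw [integral_eq_lintegral_of_nonneg_ae (Eventually.of_forall (hf.nonneg t htΘ))
          (hf.measurable t htΘ).aestronglyMeasurable, hf.mass_one t htΘ, ENNReal.toReal_one]
      simp only [V, if_true, powerIntegral, add_zero, Real.rpow_one, hmass]
      ring
    · have hd : DifferentiableAt ℝ (fun t => Real.log (f t x)) t :=
        (hx.contDiffOn_log.differentiableOn (by simp)).differentiableAt (hx.isOpen.mem_nhds ht)
      rw [partialD_add (differentiableAt_const _) (hd.const_mul _), partialD_const_mul _ hd]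
      simp [partialD, score]
  · refine ⟨fun t => -(1 + 1 / β) * f t x ^ β, contDiffOn_const.mul (hx.contDiffOn_rpow β),
      fun t ht => ?_, fun j t ht => ?_⟩
    · simp only [V, hβ.ne', if_false, powerIntegral]
      ring
    · have hd : DifferentiableAt ℝ (fun t => f t x ^ β) t :=
        ((hx.contDiffOn_rpow β).differentiableOn (by simp)).differentiableAt
          (hx.isOpen.mem_nhds ht)
      rw [partialD_const_mul _ hd, hx.partialD_rpow β ht]
      field_simp
      ring

theorem differentiableOn_iterPartial_V (hβ : 0 ≤ β) (hf : IsDensityFamily ν f Θ)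
    (hreg : Regular ν f β Θ U θ₀) {x : 𝒳} (hx : IsSmoothPoint f Θ U x) (L : List (Fin p))
    (hL : L.length < 3) : DifferentiableOn ℝ (iterPartial L fun t => V ν f β t x) U := by
  obtain ⟨φ, hφ, hV, -⟩ := exists_V_eq hβ hf hx
  have h1 := differentiableOn_iterPartial_powerIntegral hreg
  have h2 := differentiableOn_iterPartial (n := 3) hreg.isOpen hφ
  refine ((h1 L hL).fun_add (h2 L hL)).congr fun θ hθ => ?_
  rw [iterPartial_congr hreg.isOpen hV L hθ]
  exact iterPartial_add hreg.isOpen h1 h2 L hL.le hθ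

theorem differentiableAt_V (hβ : 0 ≤ β) (hf : IsDensityFamily ν f Θ)
    (hreg : Regular ν f β Θ U θ₀) {x : 𝒳} (hx : IsSmoothPoint f Θ U x) {θ : Param p}
    (hθ : θ ∈ U) : DifferentiableAt ℝ (fun t => V ν f β t x) θ :=
  (differentiableOn_iterPartial_V hβ hf hreg hx [] (by simp)).differentiableAt
    (hreg.isOpen.mem_nhds hθ)

theorem partialD_V (hβ : 0 ≤ β) (hf : IsDensityFamily ν f Θ) (hreg : Regular ν f β Θ U θ₀)
    {x : 𝒳} (hx : IsSmoothPoint f Θ U x) {θ : Param p} (hθ : θ ∈ U) (j : Fin p) :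
    partialD j (fun t => V ν f β t x) θ = (1 + β) *
      ((∫ y, score f θ y j * f θ y ^ (1 + β) ∂ν) - score f θ x j * f θ x ^ β) := by
  obtain ⟨φ, hφ, hV, hφ'⟩ := exists_V_eq hβ hf hx
  have hU := hreg.isOpen.mem_nhds hθ
  rw [partialD_congr (hV.eventuallyEq_of_mem hU), partialD_add (F := powerIntegral ν f β)
    ((differentiableOn_iterPartial_powerIntegral hreg [] (by simp)).differentiableAt hU)
    ((hφ.differentiableOn (by simp)).differentiableAt hU), hφ' j hθ,
    partialD_powerIntegral hβ hf hreg hθ]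
  ring

theorem partialD_partialD_V (hβ : 0 ≤ β) (hf : IsDensityFamily ν f Θ)
    (hreg : Regular ν f β Θ U θ₀) {x : 𝒳} (hx : IsSmoothPoint f Θ U x) {θ : Param p}
    (hθ : θ ∈ U) (j k : Fin p) :
    partialD k (partialD j fun t => V ν f β t x) θ =
      (∫ y, iterPartial [k, j] (fun t => f t y ^ (1 + β)) θ ∂ν) - (1 + β) *
        ((partialD k (fun t => score f t x j) θ + β * (score f θ x j * score f θ x k))
          * f θ x ^ β) := by
  obtain ⟨φ, hφ, hV, hφ'⟩ := exists_V_eq hβ hf hx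
  have hU := hreg.isOpen.mem_nhds hθ
  have h1 := differentiableOn_iterPartial_powerIntegral hreg
  have h2 := differentiableOn_iterPartial (n := 3) hreg.isOpen hφ
  change iterPartial [k, j] (fun t => V ν f β t x) θ = _
  rw [iterPartial_congr hreg.isOpen hV [k, j] hθ,
    iterPartial_add hreg.isOpen h1 h2 [k, j] (by simp) hθ]
  simp only
  rw [iterPartial_powerIntegral hreg [k, j] (by simp) hθ]
  have hr : DifferentiableAt ℝ (fun t => f t x ^ β) θ :=
    ((hx.contDiffOn_rpow β).differentiableOn (by simp)).differentiableAt hU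
  have hs := hx.differentiableAt_score hθ j
  change _ + partialD k (partialD j φ) θ = _
  rw [partialD_congr ((hφ' j).eventuallyEq_of_mem hU), partialD_const_mul _ (hs.fun_mul hr),
    partialD_mul hs hr, hx.partialD_rpow β hθ]
  ring

/-- The gradient of `V_θ(x)` with respect to `θ`, divided by `1 + β`. -/
noncomputable def gradV (ν : Measure 𝒳) (f : Param p → 𝒳 → ℝ) (β : ℝ) (θ : Param p) (x : 𝒳) :
    Param p :=
  WithLp.toLp 2 fun j => (1 + β)⁻¹ * partialD j (fun t => V ν f β t x) θ

/-- The Hessian matrix of `V_θ(x)` with respect to `θ`, divided by `1 + β`. -/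
noncomputable def hessV (ν : Measure 𝒳) (f : Param p → 𝒳 → ℝ) (β : ℝ) (θ : Param p) (x : 𝒳) :
    Matrix (Fin p) (Fin p) ℝ :=
  Matrix.of fun j k => (1 + β)⁻¹ * partialD k (partialD j fun t => V ν f β t x) θ

theorem gradV_apply (hβ : 0 ≤ β) (hf : IsDensityFamily ν f Θ) (hreg : Regular ν f β Θ U θ₀)
    {x : 𝒳} (hx : IsSmoothPoint f Θ U x) {θ : Param p} (hθ : θ ∈ U) (j : Fin p) :
    gradV ν f β θ x j =
      (∫ y, score f θ y j * f θ y ^ (1 + β) ∂ν) - score f θ x j * f θ x ^ β := by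
  have : (1 + β) ≠ 0 := by positivity
  simp only [gradV, partialD_V hβ hf hreg hx hθ]
  field_simp

/-- The estimating equation says that the average of the gradients vanishes. -/
theorem isRoot_iff (hβ : 0 ≤ β) (hf : IsDensityFamily ν f Θ) (hreg : Regular ν f β Θ U θ₀)
    {n : ℕ} (hn : 0 < n) {x : Fin n → 𝒳} (hx : ∀ i, IsSmoothPoint f Θ U (x i)) {θ : Param p}
    (hθ : θ ∈ U) : IsRoot ν f β Θ x θ ↔ average (gradV ν f β θ) x = 0 := by
  have hn' : (n : ℝ) ≠ 0 := by exact_mod_cast hn.ne'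
  have key : ∀ j, average (gradV ν f β θ) x j = -((1 / (n : ℝ)) *
      ∑ i, score f θ (x i) j * f θ (x i) ^ β - ∫ y, score f θ y j * f θ y ^ (1 + β) ∂ν) :=
    fun j => by
      rw [average_apply]
      simp only [gradV_apply hβ hf hreg (hx _) hθ, Finset.sum_sub_distrib, Finset.sum_const,
        Finset.card_univ, Fintype.card_fin, nsmul_eq_mul]
      field_simp
      ring
  constructor
  · rintro ⟨-, h⟩
    ext j
    rw [key j, h j]
    simp
  · intro h
    refine ⟨hreg.subset hθ, fun j => ?_⟩
    rw [← neg_eq_zero, ← key j, h]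
    rfl

/-- An interior minimizer solves the estimating equation. -/
theorem average_gradV_eq_zero_of_isMinimizer (hβ : 0 ≤ β) (hf : IsDensityFamily ν f Θ)
    (hreg : Regular ν f β Θ U θ₀) {n : ℕ} {x : Fin n → 𝒳}
    (hx : ∀ i, IsSmoothPoint f Θ U (x i)) {θ : Param p} (hθ : θ ∈ U)
    (hmin : IsMinimizer ν f β Θ x θ) : average (gradV ν f β θ) x = 0 := by
  have hU := hreg.isOpen.mem_nhds hθ
  have hlocal : IsLocalMin (objective ν f β x) θ := by
    filter_upwards [hU] with t ht using hmin.2 t (hreg.subset ht)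
  have hd : ∀ i, DifferentiableAt ℝ (fun t => V ν f β t (x i)) θ := fun i =>
    differentiableAt_V hβ hf hreg (hx i) hθ
  have h0 := hlocal.fderiv_eq_zero
  have hsum : HasFDerivAt (objective ν f β x)
      ((1 / (n : ℝ)) • ∑ i, fderiv ℝ (fun t => V ν f β t (x i)) θ) θ :=
    (HasFDerivAt.fun_sum fun i _ => (hd i).hasFDerivAt).const_mul _
  rw [hsum.fderiv] at h0
  ext j
  have hj := congrArg (fun L : Param p →L[ℝ] ℝ => L (EuclideanSpace.single j 1)) h0
  simp only [_root_.smul_apply, _root_.sum_apply, _root_.zero_apply, smul_eq_mul] at hj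
  rw [average_apply]
  simp only [gradV, ← Finset.mul_sum, partialD]
  rw [← one_div, mul_left_comm, hj, mul_zero]
  rfl

/-- The gradient is a limit of difference quotients, hence measurable. -/
theorem measurable_indicator_gradV (hβ : 0 ≤ β) (hf : IsDensityFamily ν f Θ)
    (hreg : Regular ν f β Θ U θ₀) {G : Set 𝒳} (hG : MeasurableSet G)
    (hGs : ∀ x ∈ G, IsSmoothPoint f Θ U x) {θ : Param p} (hθ : θ ∈ U) :
    Measurable (G.indicator (gradV ν f β θ)) := by
  have hVm : ∀ t ∈ U, Measurable (V ν f β t) := fun t ht => by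
    have := hf.measurable t (hreg.subset ht)
    unfold V
    split_ifs
    · exact this.log.neg
    · exact measurable_const.sub (measurable_const.mul (this.pow_const _))
  have hcomp : ∀ j, Measurable
      (G.indicator fun x => (1 + β)⁻¹ * partialD j (fun t => V ν f β t x) θ) := fun j => by
    set e : Param p := EuclideanSpace.single j 1 with he
    have hlim : Tendsto (fun n : ℕ => θ + (n : ℝ)⁻¹ • e) atTop (𝓝 θ) := by
      have h1 : Tendsto (fun n : ℕ => θ + (n : ℝ)⁻¹ • e) atTop (𝓝 (θ + (0 : ℝ) • e)) :=
        tendsto_const_nhds.add (tendsto_inv_atTop_nhds_zero_nat.smul_const e)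
      simpa using h1
    obtain ⟨N, hN⟩ := eventually_atTop.1 (hlim.eventually (hreg.isOpen.mem_nhds hθ))
    refine measurable_of_tendsto_metrizable (f := fun n : ℕ => G.indicator fun x =>
      (1 + β)⁻¹ * (((n + N : ℕ) : ℝ) * (V ν f β (θ + ((n + N : ℕ) : ℝ)⁻¹ • e) x - V ν f β θ x)))
      (fun n => ?_) ?_
    · refine Measurable.indicator ?_ hG
      exact (((hVm _ (hN _ (Nat.le_add_left _ _))).sub (hVm θ hθ)).const_mul _).const_mul _
    · rw [tendsto_pi_nhds]
      intro x
      by_cases hx : x ∈ G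
      · simp only [Set.indicator_of_mem hx]
        refine Tendsto.const_mul _ ?_
        have hd := (differentiableAt_V hβ hf hreg (hGs x hx) hθ).hasFDerivAt
        refine hd.lim e (c := fun n : ℕ => ((n + N : ℕ) : ℝ)) ?_
        simp only [Real.norm_natCast]
        exact tendsto_natCast_atTop_atTop.comp (tendsto_add_atTop_nat N)
      · simp only [Set.indicator_of_notMem hx]
        exact tendsto_const_nhds
  have heq : G.indicator (gradV ν f β θ) = fun x => WithLp.toLp 2 fun j =>
      G.indicator (fun x => (1 + β)⁻¹ * partialD j (fun t => V ν f β t x) θ) x := by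
    funext x
    by_cases hx : x ∈ G
    · simp only [Set.indicator_of_mem hx, gradV]
    · simp only [Set.indicator_of_notMem hx]
      rfl
  rw [heq]
  exact (WithLp.measurable_toLp 2 _).comp (measurable_pi_lambda _ hcomp)

end Objective

/-! ### Second moments and quadratic forms -/

section Moments

variable {𝒳 : Type*} [MeasurableSpace 𝒳] {P : Measure 𝒳} {p r : ℕ}

theorem integral_mulVec_mul_mulVec {h : 𝒳 → Param p} (hh : MemLp h 2 P)
    {S : Matrix (Fin p) (Fin p) ℝ} (hcov : ∀ j k, ∫ x, h x j * h x k ∂P = S j k)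
    (Q : Matrix (Fin r) (Fin p) ℝ) (j k : Fin r) :
    ∫ x, (Q *ᵥ h x) j * (Q *ᵥ h x) k ∂P = (Q * S * Qᵀ) j k := by
  have hcoord : ∀ a, MemLp (fun x => h x a) 2 P := fun a =>
    hh.continuousLinearMap_comp (EuclideanSpace.proj a : EuclideanSpace ℝ (Fin p) →L[ℝ] ℝ)
  have hi : ∀ a b, Integrable (fun x => Q j a * Q k b * (h x a * h x b)) P := fun a b =>
    ((hcoord a).integrable_mul (hcoord b)).const_mul _
  have e : ∀ x, (Q *ᵥ h x) j * (Q *ᵥ h x) k = ∑ a, ∑ b, Q j a * Q k b * (h x a * h x b) :=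
    fun x => by
      simp only [mulVec, dotProduct, Finset.sum_mul_sum]
      exact Finset.sum_congr rfl fun a _ => Finset.sum_congr rfl fun b _ => by ring
  simp_rw [e]
  rw [integral_finsetSum _ fun a _ => integrable_finsetSum _ fun b _ => hi a b]
  simp_rw [integral_finsetSum _ fun b _ => hi _ b, integral_const_mul, hcov]
  simp only [Matrix.mul_apply, Finset.sum_mul, transpose_apply]
  rw [Finset.sum_comm]
  exact Finset.sum_congr rfl fun a _ => Finset.sum_congr rfl fun b _ => by ring

theorem posSemidef_of_second_moments {h : 𝒳 → Param p} (hh : MemLp h 2 P)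
    {S : Matrix (Fin p) (Fin p) ℝ} (hcov : ∀ j k, ∫ x, h x j * h x k ∂P = S j k) :
    S.PosSemidef := by
  refine PosSemidef.of_dotProduct_mulVec_nonneg ?_ fun v => ?_
  · ext j k
    rw [conjTranspose_apply, star_trivial, ← hcov, ← hcov]
    simp only [mul_comm]
  · have h1 := integral_mulVec_mul_mulVec hh hcov (Matrix.of fun _ : Fin 1 => v) 0 0
    have h2 : star v ⬝ᵥ S *ᵥ v =
        ((Matrix.of fun _ : Fin 1 => v) * S * (Matrix.of fun _ : Fin 1 => v)ᵀ) 0 0 := by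
      rw [dotProduct_mulVec]
      rfl
    rw [h2, ← h1]
    exact integral_nonneg fun x => mul_self_nonneg _

open scoped MatrixOrder in
theorem exists_transpose_mul_self {N : Matrix (Fin r) (Fin r) ℝ} (hN : N.PosSemidef) :
    ∃ R : Matrix (Fin r) (Fin r) ℝ, Rᵀ * R = N := by
  refine ⟨CFC.sqrt N, ?_⟩
  have h : (CFC.sqrt N)ᵀ = CFC.sqrt N := by
    have := (CFC.sqrt_nonneg N).posSemidef.isHermitian
    rwa [IsHermitian, conjTranspose_eq_transpose_of_trivial] at this
  rw [h, CFC.sqrt_mul_sqrt_self _ hN.nonneg]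

theorem mulVec_injective_of_rank_eq {M : Matrix (Fin p) (Fin r) ℝ} (hM : M.rank = r) :
    Function.Injective M.mulVec := by
  have h := M.mulVecLin.finrank_range_add_finrank_ker
  rw [Matrix.rank] at hM
  rw [hM, Module.finrank_fin_fun] at h
  have h0 : Module.finrank ℝ M.mulVecLin.ker = 0 := by omega
  have := Submodule.finrank_eq_zero.1 h0
  exact LinearMap.ker_eq_bot.1 this

/-- The standard form of the quadratic form of a Wald statistic: the inverse of the asymptotic
covariance matrix `MᵀJ⁻¹KJ⁻¹M` is `RᵀR`, and `R` transforms it to the identity. -/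
theorem exists_standardization {J K : Matrix (Fin p) (Fin p) ℝ} {M : Matrix (Fin p) (Fin r) ℝ}
    (hJ : J.PosDef) (hK : K.PosDef) (hM : M.rank = r) :
    (Mᵀ * J⁻¹ * K * J⁻¹ * M).det ≠ 0 ∧ ∃ R : Matrix (Fin r) (Fin r) ℝ,
      Rᵀ * R = (Mᵀ * J⁻¹ * K * J⁻¹ * M)⁻¹ ∧
      (R * Mᵀ * J⁻¹) * K * (R * Mᵀ * J⁻¹)ᵀ = 1 := by
  have hJt : (J⁻¹)ᵀ = J⁻¹ := by
    have := hJ.inv.isHermitian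
    rwa [IsHermitian, conjTranspose_eq_transpose_of_trivial] at this
  have hinj : Function.Injective (J⁻¹ * M).mulVec := by
    have h1 : Function.Injective (J⁻¹).mulVec := Matrix.mulVec_injective_of_isUnit hJ.inv.isUnit
    intro a b hab
    rw [← Matrix.mulVec_mulVec, ← Matrix.mulVec_mulVec] at hab
    exact mulVec_injective_of_rank_eq hM (h1 hab)
  have hS : (Mᵀ * J⁻¹ * K * J⁻¹ * M).PosDef := by
    have := hK.conjTranspose_mul_mul_same hinj
    rw [conjTranspose_eq_transpose_of_trivial, transpose_mul, hJt] at this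
    convert this using 1
    simp only [Matrix.mul_assoc]
  set S := Mᵀ * J⁻¹ * K * J⁻¹ * M with hSdef
  refine ⟨hS.posSemidef.posDef_iff_det_ne_zero.1 hS, ?_⟩
  obtain ⟨R, hR⟩ := exists_transpose_mul_self hS.inv.posSemidef
  refine ⟨R, hR, ?_⟩
  have h1 : Rᵀ * (R * S) = 1 := by
    rw [← Matrix.mul_assoc, hR]
    exact Matrix.nonsing_inv_mul _ ((Matrix.isUnit_iff_isUnit_det _).1 hS.isUnit)
  rw [mul_eq_one_comm] at h1
  rw [← h1, hSdef, transpose_mul, transpose_mul, transpose_transpose, hJt]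
  simp only [Matrix.mul_assoc]

end Moments

/-! ### The gradient of the objective as an estimating function -/

section Model

variable {p : ℕ} {𝒳 : Type*} [MeasurableSpace 𝒳] {ν : Measure 𝒳} {f : Param p → 𝒳 → ℝ}
  {Θ U : Set (Param p)} {β : ℝ} {θ₀ : Param p}

theorem modelJ_apply (θ : Param p) (j k : Fin p) :
    modelJ ν f β θ j k = ∫ x, score f θ x j * score f θ x k * f θ x ^ (1 + β) ∂ν := by
  simp [modelJ, Jmat]

theorem rpow_mul_self_eq (hβ : 0 ≤ β) (hf : IsDensityFamily ν f Θ) {θ : Param p} (hθ : θ ∈ Θ)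
    (x : 𝒳) : f θ x ^ β * f θ x = f θ x ^ (1 + β) := by
  rw [Real.rpow_one_add' (hf.nonneg θ hθ x) (by positivity), mul_comm]

theorem aestronglyMeasurable_gradV (hβ : 0 ≤ β) (hf : IsDensityFamily ν f Θ)
    (hreg : Regular ν f β Θ U θ₀) {θ : Param p} (hθ : θ ∈ U) :
    AEStronglyMeasurable (gradV ν f β θ) (modelLaw ν f θ₀) := by
  obtain ⟨G, hGae, hGm, hG⟩ := (ae_isSmoothPoint hf hreg).exists_measurable_mem
  refine (measurable_indicator_gradV hβ hf hreg hGm hG hθ).aestronglyMeasurable.congr ?_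
  filter_upwards [hGae] with x hx using Set.indicator_of_mem hx _

theorem gradV_apply_ae (hβ : 0 ≤ β) (hf : IsDensityFamily ν f Θ) (hreg : Regular ν f β Θ U θ₀)
    (j : Fin p) : (fun x => gradV ν f β θ₀ x j) =ᵐ[modelLaw ν f θ₀]
      fun x => xiVec ν f β (f θ₀) θ₀ j - score f θ₀ x j * f θ₀ x ^ β := by
  filter_upwards [ae_isSmoothPoint hf hreg] with x hx
  rw [gradV_apply hβ hf hreg hx hreg.mem, xiVec]
  congr 1
  refine integral_congr_ae (Eventually.of_forall fun y => ?_)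
  simp only
  rw [← rpow_mul_self_eq hβ hf (hreg.subset hreg.mem)]
  ring

theorem memLp_score_mul_rpow (hβ : 0 ≤ β) (hf : IsDensityFamily ν f Θ)
    (hreg : Regular ν f β Θ U θ₀) (hJK : HasFiniteJK ν f β U) (j : Fin p) :
    MemLp (fun x => score f θ₀ x j * f θ₀ x ^ β) 2 (modelLaw ν f θ₀) := by
  have h₀ := hreg.subset hreg.mem
  have hmeas : AEStronglyMeasurable (fun x => score f θ₀ x j * f θ₀ x ^ β) (modelLaw ν f θ₀) := by
    have h1 : AEStronglyMeasurable (fun x => gradV ν f β θ₀ x j) (modelLaw ν f θ₀) :=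
      (EuclideanSpace.proj j : EuclideanSpace ℝ (Fin p) →L[ℝ] ℝ).continuous.comp_aestronglyMeasurable
        (aestronglyMeasurable_gradV hβ hf hreg hreg.mem)
    refine (aestronglyMeasurable_const (b := xiVec ν f β (f θ₀) θ₀ j)).sub h1 |>.congr ?_
    filter_upwards [gradV_apply_ae hβ hf hreg j] with x hx
    rw [Pi.sub_apply, hx]
    ring
  rw [memLp_two_iff_integrable_sq hmeas, integrable_modelLaw_iff hf h₀]
  refine (hJK θ₀ hreg.mem j j).2.congr (Eventually.of_forall fun x => ?_)
  simp only
  rw [mul_pow, ← Real.rpow_mul_natCast (hf.nonneg θ₀ h₀ x)]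
  push_cast
  rw [mul_comm β 2]
  ring

theorem memLp_gradV (hβ : 0 ≤ β) (hf : IsDensityFamily ν f Θ) (hreg : Regular ν f β Θ U θ₀)
    (hJK : HasFiniteJK ν f β U) : MemLp (gradV ν f β θ₀) 2 (modelLaw ν f θ₀) := by
  have := isProbabilityMeasure_modelLaw hf (hreg.subset hreg.mem)
  refine MemLp.of_eval_piLp fun j => ?_
  refine MemLp.ae_eq (gradV_apply_ae hβ hf hreg j).symm ?_
  exact (memLp_const _).sub (memLp_score_mul_rpow hβ hf hreg hJK j)

theorem integral_score_mul_rpow (hf : IsDensityFamily ν f Θ)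
    (hreg : Regular ν f β Θ U θ₀) (j : Fin p) :
    ∫ x, score f θ₀ x j * f θ₀ x ^ β ∂(modelLaw ν f θ₀) = xiVec ν f β (f θ₀) θ₀ j :=
  integral_modelLaw hf (hreg.subset hreg.mem) _

theorem integral_gradV (hβ : 0 ≤ β) (hf : IsDensityFamily ν f Θ) (hreg : Regular ν f β Θ U θ₀)
    (hJK : HasFiniteJK ν f β U) : ∫ x, gradV ν f β θ₀ x ∂(modelLaw ν f θ₀) = 0 := by
  have := isProbabilityMeasure_modelLaw hf (hreg.subset hreg.mem)
  ext j
  have hint := (memLp_gradV hβ hf hreg hJK).integrable one_le_two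
  rw [eval_integral_piLp fun i => hint.eval_piLp i, integral_congr_ae (gradV_apply_ae hβ hf hreg j),
    integral_sub (integrable_const _)
      ((memLp_score_mul_rpow hβ hf hreg hJK j).integrable one_le_two),
    integral_score_mul_rpow hf hreg]
  simp

theorem integral_gradV_mul_gradV (hβ : 0 ≤ β) (hf : IsDensityFamily ν f Θ)
    (hreg : Regular ν f β Θ U θ₀) (hJK : HasFiniteJK ν f β U) (j k : Fin p) :
    ∫ x, gradV ν f β θ₀ x j * gradV ν f β θ₀ x k ∂(modelLaw ν f θ₀) = modelK ν f β θ₀ j k := by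
  have h₀ := hreg.subset hreg.mem
  have := isProbabilityMeasure_modelLaw hf h₀
  set ξ := xiVec ν f β (f θ₀) θ₀ with hξ
  set a : Fin p → 𝒳 → ℝ := fun j x => score f θ₀ x j * f θ₀ x ^ β with ha
  have haL : ∀ j, MemLp (a j) 2 (modelLaw ν f θ₀) := memLp_score_mul_rpow hβ hf hreg hJK
  have hai : ∀ j, Integrable (a j) (modelLaw ν f θ₀) := fun j => (haL j).integrable one_le_two
  have haa : Integrable (fun x => a j x * a k x) (modelLaw ν f θ₀) :=
    (haL j).integrable_mul (haL k)
  have e1 : (fun x => gradV ν f β θ₀ x j * gradV ν f β θ₀ x k) =ᵐ[modelLaw ν f θ₀]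
      fun x => (ξ j * ξ k - (ξ j * a k x + ξ k * a j x)) + a j x * a k x := by
    filter_upwards [gradV_apply_ae hβ hf hreg j, gradV_apply_ae hβ hf hreg k] with x hj hk
    rw [hj, hk]
    ring
  have hmean : ∀ j, ∫ x, a j x ∂(modelLaw ν f θ₀) = ξ j := integral_score_mul_rpow hf hreg
  have hi1 : Integrable (fun x => ξ j * a k x + ξ k * a j x) (modelLaw ν f θ₀) :=
    ((hai k).const_mul _).add ((hai j).const_mul _)
  have hi2 : Integrable (fun x => ξ j * ξ k - (ξ j * a k x + ξ k * a j x)) (modelLaw ν f θ₀) :=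
    (integrable_const _).sub hi1
  rw [integral_congr_ae e1, integral_add hi2 haa, integral_sub (integrable_const _) hi1,
    integral_add ((hai k).const_mul _) ((hai j).const_mul _), 
    integral_const_mul _ (a k), integral_const_mul _ (a j), hmean, hmean, integral_modelLaw hf h₀ (fun x => a j x * a k x)]
  have e2 : ∫ x, a j x * a k x * f θ₀ x ∂ν =
      ∫ x, score f θ₀ x j * score f θ₀ x k * f θ₀ x ^ (2 * β) * f θ₀ x ∂ν := by
    refine integral_congr_ae (Eventually.of_forall fun x => ?_)
    have : f θ₀ x ^ (2 * β) = f θ₀ x ^ β * f θ₀ x ^ β := by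
      rw [mul_comm 2 β, ← sq, ← Real.rpow_mul_natCast (hf.nonneg θ₀ h₀ x)]
      norm_num
    simp only [ha, this]
    ring
  rw [e2]
  simp only [modelK, Kmat, of_apply, ← hξ, integral_const, probReal_univ, smul_eq_mul]
  ring

/-- The second derivatives of `V`, divided by `1 + β`, are integrable with mean `J_β`: the second
derivatives of `f_θ^{1+β}` that come from the two terms of `V` cancel. -/
theorem integrable_hessV_and_integral (hβ : 0 ≤ β) (hf : IsDensityFamily ν f Θ)
    (hreg : Regular ν f β Θ U θ₀) (hJK : HasFiniteJK ν f β U) (j k : Fin p) :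
    Integrable (fun x => hessV ν f β θ₀ x j k) (modelLaw ν f θ₀) ∧
      ∫ x, hessV ν f β θ₀ x j k ∂(modelLaw ν f θ₀) = modelJ ν f β θ₀ j k := by
  have h₀ := hreg.subset hreg.mem
  have := isProbabilityMeasure_modelLaw hf h₀
  have hs : (1 + β) ≠ 0 := by positivity
  set c : ℝ := (1 + β)⁻¹ * ∫ y, iterPartial [k, j] (fun t => f t y ^ (1 + β)) θ₀ ∂ν with hc
  set b : 𝒳 → ℝ := fun x => (partialD k (fun t => score f t x j) θ₀
    + β * (score f θ₀ x j * score f θ₀ x k)) * f θ₀ x ^ β with hb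
  have e1 : (fun x => hessV ν f β θ₀ x j k) =ᵐ[modelLaw ν f θ₀] fun x => c - b x := by
    filter_upwards [ae_isSmoothPoint hf hreg] with x hx
    simp only [hessV, of_apply, partialD_partialD_V hβ hf hreg hx hreg.mem, hc, hb]
    field_simp
  have e2 : (fun x => b x * f θ₀ x) =ᵐ[ν] fun x =>
      (1 + β)⁻¹ * iterPartial [k, j] (fun t => f t x ^ (1 + β)) θ₀
        - score f θ₀ x j * score f θ₀ x k * f θ₀ x ^ (1 + β) := by
    filter_upwards [ae_isSmoothPoint_or hf hreg] with x hx
    rcases hx with hx | hx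
    · have h1 : iterPartial [k, j] (fun t => f t x ^ (1 + β)) θ₀ = _ :=
        hx.partialD_partialD_rpow (1 + β) hreg.mem j k
      rw [h1, ← rpow_mul_self_eq hβ hf h₀]
      simp only [hb]
      field_simp
      ring
    · rw [iterPartial_rpow_of_eq_zero hreg.isOpen hs (fun t ht => hx t (hreg.subset ht)) _ hreg.mem,
        hx θ₀ h₀, Real.zero_rpow hs]
      ring
  have hi1 : Integrable (fun x => (1 + β)⁻¹ * iterPartial [k, j] (fun t => f t x ^ (1 + β)) θ₀) ν :=
    (hreg.diff_integral_model.1 [k, j] (by simp) θ₀ hreg.mem).const_mul _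
  have hi2 := (hJK θ₀ hreg.mem j k).1
  have hbi : Integrable b (modelLaw ν f θ₀) :=
    (integrable_modelLaw_iff hf h₀).2 ((hi1.sub hi2).congr e2.symm)
  refine ⟨((integrable_const c).sub hbi).congr e1.symm, ?_⟩
  rw [integral_congr_ae e1, integral_sub (integrable_const c) hbi, integral_modelLaw hf h₀ b,
    integral_congr_ae e2, integral_sub hi1 hi2,
    integral_const_mul (1 + β)⁻¹ (fun x => iterPartial [k, j] (fun t => f t x ^ (1 + β)) θ₀),
    modelJ_apply]
  simp only [integral_const, probReal_univ, smul_eq_mul, hc]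
  ring

/-- The passage from matrices to linear maps, as a continuous linear map. -/
noncomputable def matrixCLM (p : ℕ) : (Fin p → Fin p → ℝ) →L[ℝ] (Param p →L[ℝ] Param p) :=
  LinearMap.toContinuousLinearMap
    { toFun := fun a => toEuclideanCLM (𝕜 := ℝ) (Matrix.of a)
      map_add' := fun a b =>
        map_add (toEuclideanCLM (n := Fin p) (𝕜 := ℝ)) (Matrix.of a) (Matrix.of b)
      map_smul' := fun c a =>
        map_smul (toEuclideanCLM (n := Fin p) (𝕜 := ℝ)) c (Matrix.of a) }

theorem continuous_toEuclideanCLM : Continuous fun N : Matrix (Fin p) (Fin p) ℝ =>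
    (toEuclideanCLM (𝕜 := ℝ) N : Param p →L[ℝ] Param p) :=
  (matrixCLM p).continuous

theorem integrable_toEuclideanCLM {P : Measure 𝒳} {N : 𝒳 → Matrix (Fin p) (Fin p) ℝ}
    (hN : ∀ j k, Integrable (fun x => N x j k) P) :
    Integrable (fun x => toEuclideanCLM (𝕜 := ℝ) (N x)) P := by
  have h : Integrable (fun x => (fun j k => N x j k : Fin p → Fin p → ℝ)) P :=
    Integrable.of_eval fun j => Integrable.of_eval fun k => hN j k
  exact (matrixCLM p).integrable_comp h

theorem integral_toEuclideanCLM {P : Measure 𝒳} {N : 𝒳 → Matrix (Fin p) (Fin p) ℝ}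
    (hN : ∀ j k, Integrable (fun x => N x j k) P) {A : Matrix (Fin p) (Fin p) ℝ}
    (hA : ∀ j k, ∫ x, N x j k ∂P = A j k) :
    ∫ x, toEuclideanCLM (𝕜 := ℝ) (N x) ∂P = toEuclideanCLM (𝕜 := ℝ) A := by
  have hi := integrable_toEuclideanCLM hN
  refine ContinuousLinearMap.ext fun v => (ContinuousLinearMap.integral_apply hi v).trans ?_
  ext j
  have hv : Integrable (fun x => toEuclideanCLM (𝕜 := ℝ) (N x) v) P :=
    hi.apply_continuousLinearMap v
  rw [eval_integral_piLp fun i => hv.eval_piLp i]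
  simp only [ofLp_toEuclideanCLM, mulVec, dotProduct]
  rw [integral_finsetSum _ fun k _ => (hN j k).mul_const _]
  exact Finset.sum_congr rfl fun k _ => by rw [integral_mul_const, hA]

/-- The linear automorphism defined by an invertible matrix. -/
noncomputable def matrixEquiv (J : Matrix (Fin p) (Fin p) ℝ) (hJ : IsUnit J.det) :
    Param p ≃L[ℝ] Param p :=
  ContinuousLinearEquiv.equivOfInverse (toEuclideanCLM (𝕜 := ℝ) J) (toEuclideanCLM (𝕜 := ℝ) J⁻¹)
    (fun v => by
      rw [← mul_apply_eq_comp, ← map_mul, nonsing_inv_mul _ hJ, map_one]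
      rfl)
    (fun v => by
      rw [← mul_apply_eq_comp, ← map_mul, mul_nonsing_inv _ hJ, map_one]
      rfl)

theorem isEstimatingFunction_gradV (hβ : 0 ≤ β) (hf : IsDensityFamily ν f Θ)
    (hreg : Regular ν f β Θ U θ₀) (hJK : HasFiniteJK ν f β U)
    (hJ : IsUnit (modelJ ν f β θ₀).det) {δ : ℝ} (hδ : 0 < δ)
    (hδU : Metric.closedBall θ₀ δ ⊆ U) :
    ∃ (G : Set 𝒳) (B : 𝒳 → ℝ), (∀ x ∈ G, IsSmoothPoint f Θ U x) ∧
      IsEstimatingFunction (modelLaw ν f θ₀) (gradV ν f β) θ₀ δ G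
        (fun x => toEuclideanCLM (𝕜 := ℝ) (hessV ν f β θ₀ x)) B
        (matrixEquiv (modelJ ν f β θ₀) hJ) := by
  have hs : 0 < 1 + β := by positivity
  obtain ⟨B, hBi, hB⟩ := hreg.third_bound
  obtain ⟨G, hGae, hGm, hG⟩ := ((ae_isSmoothPoint hf hreg).and hB).exists_measurable_mem
  have hH := integrable_hessV_and_integral hβ hf hreg hJK
  have := isProbabilityMeasure_modelLaw hf (hreg.subset hreg.mem)
  refine ⟨G, fun x => ∑ j, ∑ k, ∑ l, (1 + β)⁻¹ * B l k j x, fun x hx => (hG x hx).1, ?_⟩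
  refine ⟨hδ, hGm, hGae, fun θ hθ => measurable_indicator_gradV hβ hf hreg hGm
    (fun x hx => (hG x hx).1) (hδU hθ), ?_, ?_, ?_,
    (memLp_gradV hβ hf hreg hJK).integrable one_le_two, ?_, integral_gradV hβ hf hreg hJK⟩
  · intro x hx ρ hρ θ hθ θ' hθ'
    have hsm := (hG x hx).1
    refine (norm_le_sum_abs _).trans ?_
    rw [Finset.sum_mul, Finset.sum_mul]
    refine Finset.sum_le_sum fun j _ => ?_
    -- each coordinate is estimated by means of the third derivatives
    have hd := differentiableOn_iterPartial_V hβ hf hreg hsm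
    have hpart : ∀ k, Set.EqOn
        (partialD k fun t => (1 + β)⁻¹ * partialD j (fun s => V ν f β s x) t)
        (fun t => (1 + β)⁻¹ * partialD k (partialD j fun s => V ν f β s x) t) U :=
      fun k t ht => partialD_const_mul _
        ((hd [j] (by simp)).differentiableAt (hreg.isOpen.mem_nhds ht)) k
    have key := abs_sub_sub_fderiv_le (F := fun t => (1 + β)⁻¹ * partialD j (fun s => V ν f β s x) t)
      (b := fun k l => (1 + β)⁻¹ * B l k j x) hreg.isOpen hδU
      ((hd [j] (by simp)).const_mul _)
      (fun k => ((hd [k, j] (by simp)).const_mul ((1 + β)⁻¹)).congr (hpart k))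
      (fun t ht k l => by
        rw [partialD_congr ((hpart k).eventuallyEq_of_mem (hreg.isOpen.mem_nhds ht)),
          partialD_const_mul (F := partialD k (partialD j fun s => V ν f β s x)) _
            ((hd [k, j] (by simp)).differentiableAt (hreg.isOpen.mem_nhds ht)), abs_mul,
          abs_of_pos (inv_pos.2 hs)]
        gcongr
        exact (hG x hx).2 t ht l k j) hρ hθ hθ'
    refine le_trans (le_of_eq ?_) key
    congr 1
    simp only [PiLp.sub_apply, gradV]
    congr 1
    rw [dual_apply_eq_sum]
    simp only [ofLp_toEuclideanCLM, mulVec, dotProduct, hessV, of_apply]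
    refine Finset.sum_congr rfl fun k _ => ?_
    congr 1
    exact (hpart k hreg.mem).symm
  · exact integrable_toEuclideanCLM fun j k => (hH j k).1
  · exact integrable_finsetSum _ fun j _ => integrable_finsetSum _ fun k _ =>
      integrable_finsetSum _ fun l _ => (hBi l k j).const_mul _
  · exact integral_toEuclideanCLM (fun j k => (hH j k).1) fun j k => (hH j k).2

end Model

/-! ### The Wald-type statistic -/

section Wald

open scoped RealInnerProductSpace

variable {p r : ℕ} {𝒳 : Type*} [MeasurableSpace 𝒳] {ν : Measure 𝒳} {f : Param p → 𝒳 → ℝ}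
  {Θ U : Set (Param p)} {β : ℝ} {θ₀ : Param p} {m : Param p → Fin r → ℝ}

/-- The asymptotic covariance matrix `MᵀJ⁻¹KJ⁻¹M` of `√n m(T)`. -/
noncomputable def waldCov (ν : Measure 𝒳) (f : Param p → 𝒳 → ℝ) (β : ℝ) (m : Param p → Fin r → ℝ)
    (θ : Param p) : Matrix (Fin r) (Fin r) ℝ :=
  (Mmat m θ)ᵀ * (modelJ ν f β θ)⁻¹ * modelK ν f β θ * (modelJ ν f β θ)⁻¹ * Mmat m θ

theorem wald_eq_inner (n : ℕ) (θ : Param p) :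
    wald ν f β m n θ = n * ⟪WithLp.toLp 2 (m θ),
      toEuclideanCLM (𝕜 := ℝ) (waldCov ν f β m θ)⁻¹ (WithLp.toLp 2 (m θ))⟫ := by
  rw [inner_toEuclideanCLM]
  rfl

theorem continuousAt_matrix_inv_of_det_ne_zero {q : ℕ} {N : Matrix (Fin q) (Fin q) ℝ}
    (hN : N.det ≠ 0) : ContinuousAt (fun N : Matrix (Fin q) (Fin q) ℝ => N⁻¹) N := by
  refine continuousAt_matrix_inv _ ?_
  rw [Ring.inverse_eq_inv']
  exact continuousAt_inv₀ hN

theorem continuousAt_matrix_mul {Y : Type*} [TopologicalSpace Y] {a b c : ℕ}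
    {A : Y → Matrix (Fin a) (Fin b) ℝ} {B : Y → Matrix (Fin b) (Fin c) ℝ} {y : Y}
    (hA : ContinuousAt A y) (hB : ContinuousAt B y) : ContinuousAt (fun z => A z * B z) y := by
  have h : Continuous fun z : Matrix (Fin a) (Fin b) ℝ × Matrix (Fin b) (Fin c) ℝ => z.1 * z.2 :=
    continuous_fst.matrix_mul continuous_snd
  exact h.continuousAt.comp (hA.prodMk hB)

theorem continuousAt_Mmat (hU : IsOpen U) (hm : ContDiffOn ℝ 1 m U) {θ : Param p} (hθ : θ ∈ U) :
    ContinuousAt (Mmat m) θ := by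
  refine continuousAt_pi.2 fun i => continuousAt_pi.2 fun k => ?_
  have hk : ContDiffOn ℝ 1 (fun t => m t k) U := contDiffOn_pi.1 hm k
  exact (contDiffOn_partialD (n := 0) hU (by simpa using hk) i).continuousOn.continuousAt
    (hU.mem_nhds hθ)

theorem continuousAt_waldCov (hU : IsOpen U) (hm : ContDiffOn ℝ 1 m U)
    (hJ : ContinuousOn (modelJ ν f β) U) (hK : ContinuousOn (modelK ν f β) U) {θ : Param p}
    (hθ : θ ∈ U) (hdet : (modelJ ν f β θ).det ≠ 0) : ContinuousAt (waldCov ν f β m) θ := by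
  have hM := continuousAt_Mmat hU hm hθ
  have hJi : ContinuousAt (fun t => (modelJ ν f β t)⁻¹) θ :=
    (continuousAt_matrix_inv_of_det_ne_zero hdet).comp_of_eq
      (hJ.continuousAt (hU.mem_nhds hθ)) rfl
  have hKc := hK.continuousAt (hU.mem_nhds hθ)
  have hMt : ContinuousAt (fun t => (Mmat m t)ᵀ) θ :=
    (continuous_id.matrix_transpose (A := fun N : Matrix (Fin p) (Fin r) ℝ => N)).continuousAt.comp
      hM
  exact continuousAt_matrix_mul (continuousAt_matrix_mul (continuousAt_matrix_mul
    (continuousAt_matrix_mul hMt hJi) hKc) hJi) hM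

theorem continuousAt_wald (hU : IsOpen U) (hm : ContDiffOn ℝ 1 m U)
    (hJ : ContinuousOn (modelJ ν f β) U) (hK : ContinuousOn (modelK ν f β) U) {θ : Param p}
    (hθ : θ ∈ U) (hdet : (modelJ ν f β θ).det ≠ 0) (hdet' : (waldCov ν f β m θ).det ≠ 0) (n : ℕ) :
    ContinuousAt (wald ν f β m n) θ := by
  have hS : ContinuousAt (fun t => (waldCov ν f β m t)⁻¹) θ :=
    (continuousAt_matrix_inv_of_det_ne_zero hdet').comp_of_eq
      (continuousAt_waldCov hU hm hJ hK hθ hdet) rfl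
  have hmc : ContinuousAt m θ := hm.continuousOn.continuousAt (hU.mem_nhds hθ)
  have hc : Continuous fun z : (Fin r → ℝ) × Matrix (Fin r) (Fin r) ℝ =>
      (n : ℝ) * (z.1 ⬝ᵥ (z.2 *ᵥ z.1)) :=
    continuous_const.mul (continuous_fst.dotProduct (continuous_snd.matrix_mulVec continuous_fst))
  exact hc.continuousAt.comp (hmc.prodMk hS)

theorem exists_hasFDerivAt_toLp (hU : IsOpen U) (hm : ContDiffOn ℝ 1 m U) (h₀ : θ₀ ∈ U) :
    ∃ M : Param p →L[ℝ] EuclideanSpace ℝ (Fin r),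
      HasFDerivAt (fun θ => WithLp.toLp 2 (m θ)) M θ₀ ∧
      ∀ v, M v = WithLp.toLp 2 ((Mmat m θ₀)ᵀ *ᵥ v) := by
  have hd : ∀ k, DifferentiableAt ℝ (fun t => m t k) θ₀ := fun k =>
    ((contDiffOn_pi.1 hm k).differentiableOn (by simp)).differentiableAt (hU.mem_nhds h₀)
  have hd' : DifferentiableAt ℝ (fun θ => WithLp.toLp 2 (m θ)) θ₀ :=
    differentiableAt_euclidean.2 hd
  refine ⟨_, hd'.hasFDerivAt, fun v => ?_⟩
  ext k
  have h1 : HasFDerivAt (fun t => m t k) ((EuclideanSpace.proj k : EuclideanSpace ℝ (Fin r) →L[ℝ] ℝ)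
      ∘L fderiv ℝ (fun θ => WithLp.toLp 2 (m θ)) θ₀) θ₀ :=
    (EuclideanSpace.proj k : EuclideanSpace ℝ (Fin r) →L[ℝ] ℝ).hasFDerivAt.comp θ₀ hd'.hasFDerivAt
  have h2 : fderiv ℝ (fun t => m t k) θ₀ v
      = fderiv ℝ (fun θ => WithLp.toLp 2 (m θ)) θ₀ v k := by
    rw [h1.fderiv]
    rfl
  rw [← h2, dual_apply_eq_sum]
  rfl

end Wald

section Main

variable {p r : ℕ} {𝒳 Ω : Type*} [MeasurableSpace 𝒳] [MeasurableSpace Ω] {ν : Measure 𝒳}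
  {f : Param p → 𝒳 → ℝ} {Θ U : Set (Param p)} {β : ℝ} {θ₀ : Param p} {m : Param p → Fin r → ℝ}
  {μ : Measure Ω} [IsProbabilityMeasure μ] {X : ℕ → Ω → 𝒳}

theorem posDef_modelK (hβ : 0 ≤ β) (hf : IsDensityFamily ν f Θ) (hreg : Regular ν f β Θ U θ₀)
    (hJK : HasFiniteJK ν f β U) (hK₀ : (modelK ν f β θ₀).det ≠ 0) :
    (modelK ν f β θ₀).PosDef :=
  (posSemidef_of_second_moments (memLp_gradV hβ hf hreg hJK)
    (integral_gradV_mul_gradV hβ hf hreg hJK)).posDef_iff_det_ne_zero.2 hK₀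

theorem posDef_modelJ (hreg : Regular ν f β Θ U θ₀) : (modelJ ν f β θ₀).PosDef :=
  hreg.posDef

/-- Existence of a consistent sequence of roots of the estimating equation. -/
theorem exists_consistent_isRoot (hβ : 0 ≤ β) (hf : IsDensityFamily ν f Θ)
    (hreg : Regular ν f β Θ U θ₀) (hJK : HasFiniteJK ν f β U)
    (hJ : ContinuousOn (modelJ ν f β) U) (hK : ContinuousOn (modelK ν f β) U)
    (hK₀ : (modelK ν f β θ₀).det ≠ 0) (hm : ContDiffOn ℝ 1 m U) (hM : (Mmat m θ₀).rank = r)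
    (hX : ∀ i, Measurable (X i)) (hindep : iIndepFun X μ)
    (hlaw : ∀ i, μ.map (X i) = modelLaw ν f θ₀) :
    ∃ T : (n : ℕ) → (Fin n → 𝒳) → Param p, (∀ n, Measurable (T n)) ∧
      (∀ᶠ q in inProb μ, IsRoot ν f β Θ (sample X q.1 q.2) (T q.1 (sample X q.1 q.2))) ∧
      Tendsto (fun q : ℕ × Ω => T q.1 (sample X q.1 q.2)) (inProb μ) (𝓝 θ₀) ∧
      ∀ n, Measurable (fun ω => wald ν f β m n (T n (sample X n ω))) := by
  have hdet := (posDef_modelJ hreg).det_pos.ne'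
  have hdet' : (waldCov ν f β m θ₀).det ≠ 0 :=
    (exists_standardization (posDef_modelJ hreg) (posDef_modelK hβ hf hreg hJK hK₀) hM).1
  have hU := hreg.isOpen.mem_nhds hreg.mem
  -- on a small ball, the Wald statistic is a continuous function of the estimate
  have hev1 : ∀ᶠ θ in 𝓝 θ₀, (modelJ ν f β θ).det ≠ 0 :=
    ((continuous_id.matrix_det.continuousAt (x := modelJ ν f β θ₀)).comp_of_eq
      (hJ.continuousAt hU) rfl).eventually_ne hdet
  have hev2 : ∀ᶠ θ in 𝓝 θ₀, (waldCov ν f β m θ).det ≠ 0 :=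
    ((continuous_id.matrix_det.continuousAt (x := waldCov ν f β m θ₀)).comp_of_eq
      (continuousAt_waldCov hreg.isOpen hm hJ hK hreg.mem hdet) rfl).eventually_ne hdet'
  obtain ⟨δ, hδ, hball⟩ := Metric.nhds_basis_closedBall.eventually_iff.1
    ((hev1.and hev2).and (hreg.isOpen.eventually_mem hreg.mem))
  obtain ⟨G, B, hG, hest⟩ := isEstimatingFunction_gradV hβ hf hreg hJK hdet.isUnit hδ
    fun θ hθ => (hball hθ).2
  obtain ⟨T, hTm, hTball, hroot, hTlim⟩ := hest.exists_consistent_root hX hindep hlaw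
  refine ⟨T, hTm, ?_, hTlim, fun n => ?_⟩
  · filter_upwards [hroot, eventually_sample_mem hX hlaw hest.ae_mem,
      tendsto_fst_inProb.eventually (eventually_gt_atTop 0)] with q h1 h2 h3
    exact (isRoot_iff hβ hf hreg h3 (fun i => hG _ (h2 i)) (hball (hTball _ _)).2).2 h1
  · have hc : ContinuousOn (wald ν f β m n) (Metric.closedBall θ₀ δ) := fun θ hθ =>
      (continuousAt_wald hreg.isOpen hm hJ hK (hball hθ).2 (hball hθ).1.1 (hball hθ).1.2
        n).continuousWithinAt
    have hsm : Measurable fun ω => T n (sample X n ω) :=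
      (hTm n).comp (measurable_pi_lambda _ fun i => hX i)
    exact (continuousOn_iff_continuous_domRestrict.1 hc).measurable.comp
      (hsm.subtype_mk (h := fun ω => hTball n _))

/-- The Wald-type statistic at a consistent sequence of estimators that minimize the objective or
solve the estimating equation is asymptotically chi-square. -/
theorem tendstoInDistribution_wald (hβ : 0 ≤ β) (hf : IsDensityFamily ν f Θ)
    (hreg : Regular ν f β Θ U θ₀) (hJK : HasFiniteJK ν f β U)
    (hJ : ContinuousOn (modelJ ν f β) U) (hK : ContinuousOn (modelK ν f β) U)
    (hK₀ : (modelK ν f β θ₀).det ≠ 0) (hm : ContDiffOn ℝ 1 m U) (hM : (Mmat m θ₀).rank = r)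
    (hnull : m θ₀ = 0) (hX : ∀ i, Measurable (X i)) (hindep : iIndepFun X μ)
    (hlaw : ∀ i, μ.map (X i) = modelLaw ν f θ₀) {T : ℕ → Ω → Param p}
    (hT : ∀ᶠ q in inProb μ, IsMinimizer ν f β Θ (sample X q.1 q.2) (T q.1 q.2) ∨
      IsRoot ν f β Θ (sample X q.1 q.2) (T q.1 q.2))
    (hTlim : Tendsto (fun q : ℕ × Ω => T q.1 q.2) (inProb μ) (𝓝 θ₀))
    (hW : ∀ n, AEMeasurable (fun ω => wald ν f β m n (T n ω)) μ) :
    TendstoInDistribution (fun n ω => wald ν f β m n (T n ω)) atTop (fun x : ℝ => x)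
      (fun _ => μ) (chiSquare r) := by
  have hdet := (posDef_modelJ hreg).det_pos.ne'
  obtain ⟨hdet', R, hR, hstd⟩ :=
    exists_standardization (posDef_modelJ hreg) (posDef_modelK hβ hf hreg hJK hK₀) hM
  have hU := hreg.isOpen.mem_nhds hreg.mem
  obtain ⟨δ, hδ, hδU⟩ := Metric.nhds_basis_closedBall.mem_iff.1 hU
  obtain ⟨G, B, hG, hest⟩ := isEstimatingFunction_gradV hβ hf hreg hJK hdet.isUnit hδ hδU
  have hL2 := memLp_gradV hβ hf hreg hJK
  have hcov := integral_gradV_mul_gradV hβ hf hreg hJK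
  have hroot : ∀ᶠ q in inProb μ, average (gradV ν f β (T q.1 q.2)) (sample X q.1 q.2) = 0 := by
    filter_upwards [hT, hTlim.eventually (hreg.isOpen.eventually_mem hreg.mem),
      eventually_sample_mem hX hlaw hest.ae_mem,
      tendsto_fst_inProb.eventually (eventually_gt_atTop 0)] with q h1 h2 h3 h4
    rcases h1 with h1 | h1
    · exact average_gradV_eq_zero_of_isMinimizer hβ hf hreg (fun i => hG _ (h3 i)) h2 h1
    · exact (isRoot_iff hβ hf hreg h4 (fun i => hG _ (h3 i)) h2).1 h1
  obtain ⟨M, hMd, hMv⟩ := exists_hasFDerivAt_toLp hreg.isOpen hm hreg.mem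
  have hN : ContinuousAt (fun θ => toEuclideanCLM (𝕜 := ℝ) (waldCov ν f β m θ)⁻¹) θ₀ :=
    continuous_toEuclideanCLM.continuousAt.comp
      ((continuousAt_matrix_inv_of_det_ne_zero hdet').comp_of_eq
        (continuousAt_waldCov hreg.isOpen hm hJ hK hreg.mem hdet) rfl)
  have hquad : ∀ v : EuclideanSpace ℝ (Fin r),
      inner ℝ v (toEuclideanCLM (𝕜 := ℝ) (waldCov ν f β m θ₀)⁻¹ v)
        = ‖toEuclideanCLM (𝕜 := ℝ) R v‖ ^ 2 := fun v => by
    rw [inner_toEuclideanCLM, waldCov, ← hR, ← Matrix.mulVec_mulVec, dotProduct_mulVec,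
      vecMul_transpose, EuclideanSpace.real_norm_sq_eq]
    simp only [dotProduct, ofLp_toEuclideanCLM, sq]
  have hinfl : ∀ x j, toEuclideanCLM (𝕜 := ℝ) R
      (M ((matrixEquiv (modelJ ν f β θ₀) hdet.isUnit).symm (gradV ν f β θ₀ x))) j
        = ((R * (Mmat m θ₀)ᵀ * (modelJ ν f β θ₀)⁻¹) *ᵥ gradV ν f β θ₀ x) j := fun x j => by
    rw [hMv, toEuclideanCLM_toLp, ← Matrix.mulVec_mulVec, ← Matrix.mulVec_mulVec]
    rfl
  simp only [wald_eq_inner] at hW ⊢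
  refine hest.tendstoInDistribution_quadratic hX hindep hlaw hL2
    (posSemidef_of_second_moments hL2 hcov) hcov hTlim hroot
    (m := fun θ => WithLp.toLp 2 (m θ))
    (N := fun θ => toEuclideanCLM (𝕜 := ℝ) (waldCov ν f β m θ)⁻¹)
    (by simp [hnull]) hMd hN hquad (fun j k => ?_) hW
  simp only [hinfl]
  rw [integral_mulVec_mul_mulVec hL2 hcov]
  exact congrFun (congrFun hstd j) k

end Main

end MDPD

theorem mainTheorem1 {p r : ℕ} {𝒳 Ω : Type*} [MeasurableSpace 𝒳] [MeasurableSpace Ω]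
    (ν : Measure 𝒳) [SigmaFinite ν] (f : MDPD.Param p → 𝒳 → ℝ) (Θ U : Set (MDPD.Param p))
    (β : ℝ) (hβ : 0 ≤ β) (m : MDPD.Param p → Fin r → ℝ) (θ₀ : MDPD.Param p)
    (hf : MDPD.IsDensityFamily ν f Θ)
    (hreg : MDPD.Regular ν f β Θ U θ₀)
    (hJK : MDPD.HasFiniteJK ν f β U)
    (hJ : ContinuousOn (MDPD.modelJ ν f β) U)
    (hK : ContinuousOn (MDPD.modelK ν f β) U)
    (hK₀ : (MDPD.modelK ν f β θ₀).det ≠ 0)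
    (hm : ContDiffOn ℝ 1 m U)
    (hM : (MDPD.Mmat m θ₀).rank = r)
    (hnull : θ₀ ∈ {θ ∈ Θ | m θ = 0})
    (μ : Measure Ω) [IsProbabilityMeasure μ] (X : ℕ → Ω → 𝒳)
    (hX : ∀ i, Measurable (X i)) (hindep : iIndepFun X μ)
    (hlaw : ∀ i, μ.map (X i) = MDPD.modelLaw ν f θ₀) :
    (∃ T : (n : ℕ) → (Fin n → 𝒳) → MDPD.Param p,
      (∀ n, Measurable (T n)) ∧
      Tendsto (fun n => μ {ω | ¬ MDPD.IsRoot ν f β Θ (MDPD.sample X n ω)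
        (T n (MDPD.sample X n ω))}) atTop (𝓝 0) ∧
      TendstoInMeasure μ (fun n ω => T n (MDPD.sample X n ω)) atTop (fun _ => θ₀) ∧
      ∀ n, AEMeasurable
        (fun ω => MDPD.wald ν f β m n (T n (MDPD.sample X n ω))) μ) ∧
    (∀ T : (n : ℕ) → (Fin n → 𝒳) → MDPD.Param p,
      (∀ n, Measurable (T n)) →
      Tendsto (fun n => μ {ω | ¬ (MDPD.IsMinimizer ν f β Θ (MDPD.sample X n ω)
          (T n (MDPD.sample X n ω)) ∨
        MDPD.IsRoot ν f β Θ (MDPD.sample X n ω) (T n (MDPD.sample X n ω)))}) atTop (𝓝 0) →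
      TendstoInMeasure μ (fun n ω => T n (MDPD.sample X n ω)) atTop (fun _ => θ₀) →
      (∀ n, AEMeasurable
        (fun ω => MDPD.wald ν f β m n (T n (MDPD.sample X n ω))) μ) →
      TendstoInDistribution (fun n ω => MDPD.wald ν f β m n (T n (MDPD.sample X n ω))) atTop
        (fun x : ℝ => x) (fun _ => μ) (MDPD.chiSquare r)) := by
  refine ⟨?_, fun T _ hroot hlim hW => ?_⟩
  · obtain ⟨T, hTm, hroot, hlim, hW⟩ := MDPD.exists_consistent_isRoot hβ hf hreg hJK hJ hK hK₀ hm hM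
      hX hindep hlaw
    exact ⟨T, hTm, MDPD.eventually_inProb.1 hroot,
      MDPD.tendstoInMeasure_iff_tendsto_inProb.2 hlim, fun n => (hW n).aemeasurable⟩
  · exact MDPD.tendstoInDistribution_wald hβ hf hreg hJK hJ hK hK₀ hm hM hnull.2 hX hindep hlaw
      (T := fun n ω => T n (MDPD.sample X n ω))
      (MDPD.eventually_inProb (P := fun q => MDPD.IsMinimizer ν f β Θ (MDPD.sample X q.1 q.2)
        (T q.1 (MDPD.sample X q.1 q.2)) ∨ MDPD.IsRoot ν f β Θ (MDPD.sample X q.1 q.2)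
        (T q.1 (MDPD.sample X q.1 q.2))) |>.2 hroot)
      ((MDPD.tendstoInMeasure_iff_tendsto_inProb (F := fun n ω => T n (MDPD.sample X n ω))).1 hlim) hW
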